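/- Let $\Bbbk$ be a field of characteristic zero. Let $(X,Y,I)$ be a root datum associated to a symmetrisable generalised Cartan matrix $C=(C_{ij})_{i,j\in I}$ ($I$ finite): $X,Y$ are finitely generated free $\mathbb Z$-modules with a perfect pairing $\langle\cdot,\cdot\rangle:Y\times X\to\mathbb Z$, with linearly independent simple roots $\alpha_i\in X$ and linearly independent simple coroots $\check\alpha_i\in Y$ such that $\langle\check\alpha_i,\alpha_j\rangle=C_{ij}$. The non-deformable relations for $X_i^\pm$ ($i\in I$) and the $\mathbb Z$-module $Y$ are $$[\check\mu,\check\mu']=0,\qquad[\check\mu,X_i^\pm]=\pm\langle\check\mu,\alpha_i\rangle X_i^\pm,\qquad[X_i^+,X_j^-]=0\ \ (i\ne j).$$ Let $\mathfrak g_F$ be the Lie $\Bbbk$-algebra generated by $X_i^\pm$ ($i\in I$) and the $\mathbb Z$-module $Y$ subject to these relations, and let $\tilde{\mathfrak g}$ be the Kac-Moody algebra without Serre relations, the quotient of $\mathfrak g_F$ by the relations $[X_i^+,X_i^-]=\check\alpha_i$ ($i\in I$). A colouring $\psi$ consists of two families $\psi^{\pm}(n,k)\in\Bbbk[[h]]$,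 indexed by the integers $1\le k\le n$; put $[\psi](n,k)=\psi^-(n,k)\,\psi^+(n,n-k+1)$. The colouring $\psi$ is called $h$-admissible if $[\psi](n,k)\equiv k(n-k+1)$ modulo $h$ for all $1\le k\le n$, if $[\psi]$ is given on these pairs by an element of $\Bbbk[u,v][[h]]$ (again denoted by $[\psi]$), if $[\psi](n,n+1)=0$ for all $n\geq 0$, and if $[\psi](-n-2,k)=[\psi](n,n+k+1)$ for all $n,k\ge1$. Let $\psi=(\psi_i)_{i\in I}$ be a family of $h$-admissible colourings. Then the following holds. 1) For every $i\in I$, there is a unique sequence $S^{\psi_i}_h=(S^{\psi_i}_{h,a})_{a\in\mathbb N}$ in $\Bbbk[u][[h]]$, converging to zero $h$-adically, which is a solution of the GQE equation of degree $-1$ of $\psi_i$: for all integers $0\le p\le n$, $$\sum_{a=0}^p\Big(\prod_{l=p-a+1}^{p}[\psi_i](n,l)\Big)\,S^{\psi_i}_{h,a}(n-2p+2a)=\begin{cases}[\psi_i](n,p+1)&\text{if }p+1\le n,\\0&\text{if }p=n.\end{cases}$$ 2) Let the GQE algebra without Serre relations $\tilde U_h(\mathfrak g,\psi)$ be the $\Bbbk[[h]]$-algebra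 topologically generated by $X_i^\pm$ ($i\in I$) and the $\mathbb Z$-module $Y$, subject to the non-deformable relations and to $$X_i^+X_i^-=\sum_{a\in\mathbb N}(X_i^-)^a\,S^{\psi_i}_{h,a}(\check\alpha_i)\,(X_i^+)^a\qquad(i\in I),$$ i.e. the quotient of the algebra of formal power series in $h$ over the free $\Bbbk$-algebra on these generators by the $h$-adic closure of the two-sided ideal generated by the relations. Then $\tilde U_h(\mathfrak g,\psi)$ is a formal deformation of $U(\tilde{\mathfrak g})$ as a $\mathfrak g_F$-pointed algebra: the $\Bbbk[[h]]$-module $\tilde U_h(\mathfrak g,\psi)$ is topologically free (isomorphic to $V_0[[h]]$ for some $\Bbbk$-vector space $V_0$), and there is an isomorphism of $\Bbbk$-algebras $\tilde U_h(\mathfrak g,\psi)/h\,\tilde U_h(\mathfrak g,\psi)\simeq U(\tilde{\mathfrak g})$ which is compatible with the canonical morphisms from $U(\mathfrak g_F)$ (it sends the classes of the generators $X_i^\pm,\check\mu$ to $X_i^\pm,\check\mu$). -/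

import Mathlib

universe u v

noncomputable section

namespace GQE

open PowerSeries

attribute [local instance 100] LieRing.ofAssociativeRing

/-! ### Modules and algebras over the power series ring `k⟦h⟧` (the variable `h` is `PowerSeries.X`) -/

/-- The space `V₀⟦h⟧` of functions `ℕ → V₀`, where `v` stands for the series `∑ v m hᵐ`. -/
def FormalModule (V₀ : Type v) : Type v := ℕ → V₀

instance {V₀ : Type v} [AddCommGroup V₀] : AddCommGroup (FormalModule V₀) :=
  inferInstanceAs (AddCommGroup (ℕ → V₀))

/-- `(c v)_m = ∑_{p+q=m} c_p v_q`. -/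
instance (k : Type u) [Field k] {V₀ : Type v} [AddCommGroup V₀] [Module k V₀] :
    Module k⟦X⟧ (FormalModule V₀) where
  smul c v := fun m => ∑ pq ∈ Finset.HasAntidiagonal.antidiagonal m, coeff pq.1 c • v pq.2
  one_smul v := by
    funext m
    change ∑ pq ∈ Finset.HasAntidiagonal.antidiagonal m, coeff pq.1 (1 : k⟦X⟧) • v pq.2 = v m
    rw [Finset.sum_eq_single (0, m)]
    · simp
    · rintro ⟨a, b⟩ hab hne
      have ha : a ≠ 0 := by
        rintro rfl
        simp at hab
        exact hne (by rw [hab])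
      simp [coeff_one, ha]
    · intro hn
      simp at hn
  mul_smul c d v := by
    funext m
    change ∑ pq ∈ Finset.HasAntidiagonal.antidiagonal m, coeff pq.1 (c * d) • v pq.2 =
      ∑ pq ∈ Finset.HasAntidiagonal.antidiagonal m, coeff pq.1 c •
        ∑ rs ∈ Finset.HasAntidiagonal.antidiagonal pq.2, coeff rs.1 d • v rs.2
    simp only [coeff_mul, Finset.sum_smul, Finset.smul_sum, smul_smul]
    rw [Finset.sum_sigma', Finset.sum_sigma']
    refine Finset.sum_nbij' (fun x => ⟨(x.2.1, x.2.2 + x.1.2), (x.2.2, x.1.2)⟩)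
      (fun x => ⟨(x.1.1 + x.2.1, x.2.2), (x.1.1, x.2.1)⟩) ?_ ?_ ?_ ?_ ?_ <;>
      rintro ⟨⟨a, b⟩, ⟨c', d'⟩⟩ hx <;>
      simp only [Finset.mem_sigma, Finset.HasAntidiagonal.mem_antidiagonal] at hx ⊢ <;>
      obtain ⟨h1, h2⟩ := hx
    · exact ⟨by omega, trivial⟩
    · exact ⟨by omega, trivial⟩
    · subst h2; rfl
    · subst h2; rfl
  smul_zero c := by
    funext m
    exact Finset.sum_eq_zero fun pq _ => smul_zero _
  smul_add c v v' := by
    funext m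
    change ∑ pq ∈ Finset.HasAntidiagonal.antidiagonal m, coeff pq.1 c • (v pq.2 + v' pq.2) = _ + _
    simp only [smul_add, Finset.sum_add_distrib]
    rfl
  add_smul c d v := by
    funext m
    change ∑ pq ∈ Finset.HasAntidiagonal.antidiagonal m, coeff pq.1 (c + d) • v pq.2 = _ + _
    simp only [map_add, add_smul, Finset.sum_add_distrib]
    rfl
  zero_smul v := by
    funext m
    exact Finset.sum_eq_zero fun pq _ => by simp

/-- A `k⟦h⟧`-module is topologically free if it is isomorphic to `V₀⟦h⟧` for some `k`-vector
space `V₀`. -/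
def IsTopologicallyFree (k : Type u) [Field k] (V : Type v) [AddCommGroup V] [Module k⟦X⟧ V] :
    Prop :=
  ∃ (V₀ : Type v) (_ : AddCommGroup V₀) (_ : Module k V₀), Nonempty (FormalModule V₀ ≃ₗ[k⟦X⟧] V)

section algebra

variable (k : Type u) [Field k]

/-- The `h`-adic closure of a two-sided ideal `J` of a `k⟦h⟧`-algebra `A`:
the elements of `⋂ₘ (J + hᵐ A)`. -/
def hClosure {A : Type v} [Ring A] [Algebra k⟦X⟧ A] (J : TwoSidedIdeal A) : TwoSidedIdeal A :=
  TwoSidedIdeal.mk' {x | ∀ m : ℕ, ∃ y ∈ J, ∃ z : A, x = y + (X : k⟦X⟧) ^ m • z}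
    (fun m => ⟨0, J.zero_mem, 0, by simp⟩)
    (fun {x x'} hx hx' m => by
      obtain ⟨y, hy, z, rfl⟩ := hx m
      obtain ⟨y', hy', z', rfl⟩ := hx' m
      exact ⟨y + y', J.add_mem hy hy', z + z', by rw [smul_add]; abel⟩)
    (fun {x} hx m => by
      obtain ⟨y, hy, z, rfl⟩ := hx m
      exact ⟨-y, J.neg_mem hy, -z, by rw [smul_neg]; abel⟩)
    (fun {a x} hx m => by
      obtain ⟨y, hy, z, rfl⟩ := hx m
      exact ⟨a * y, J.mul_mem_left _ _ hy, a * z, by rw [mul_add, mul_smul_comm]⟩)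
    (fun {x a} hx m => by
      obtain ⟨y, hy, z, rfl⟩ := hx m
      exact ⟨y * a, J.mul_mem_right _ _ hy, z * a, by rw [add_mul, smul_mul_assoc]⟩)

/-- The two-sided ideal `h A` of a `k⟦h⟧`-algebra `A`. -/
def hIdeal (A : Type v) [Ring A] [Algebra k⟦X⟧ A] : TwoSidedIdeal A :=
  TwoSidedIdeal.mk' {x | ∃ z : A, x = (X : k⟦X⟧) • z}
    ⟨0, by simp⟩
    (fun {x x'} ⟨z, hz⟩ ⟨z', hz'⟩ => ⟨z + z', by rw [hz, hz', smul_add]⟩)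
    (fun {x} ⟨z, hz⟩ => ⟨-z, by rw [hz, smul_neg]⟩)
    (fun {a x} ⟨z, hz⟩ => ⟨a * z, by rw [hz, mul_smul_comm]⟩)
    (fun {x a} ⟨z, hz⟩ => ⟨z * a, by rw [hz, smul_mul_assoc]⟩)

/-- The specialisation `A / h A` at `h = 0` of a `k⟦h⟧`-algebra `A`. -/
abbrev Specialisation (A : Type v) [Ring A] [Algebra k⟦X⟧ A] : Type v :=
  (hIdeal k A).ringCon.Quotient

/-- The projection from `A` to `A / h A`, as a morphism of `k`-algebras. -/
def specialisationMap (A : Type v) [Ring A] [Algebra k⟦X⟧ A] [Algebra k A] :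
    A →ₐ[k] Specialisation k A :=
  { (hIdeal k A).ringCon.mk' with commutes' := fun _ => rfl }

/-- Let `D` be a `k`-algebra. A `D`-pointed algebra is an algebra `A` with a morphism of
`k`-algebras `D → A`. The `D`-pointed `k⟦h⟧`-algebra `(A, point)` is a formal deformation of the
`D`-pointed `k`-algebra `(A₀, point₀)` if `A` is topologically free and if `A / h A` and `A₀` are
isomorphic as `D`-pointed `k`-algebras. -/
def IsFormalDeformation {D : Type*} [Ring D] [Algebra k D]
    {A₀ : Type*} [Ring A₀] [Algebra k A₀] (point₀ : D →ₐ[k] A₀)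
    {A : Type*} [Ring A] [Algebra k⟦X⟧ A] [Algebra k A] [IsScalarTower k k⟦X⟧ A]
    (point : D →ₐ[k] A) : Prop :=
  IsTopologicallyFree k A ∧
    ∃ e : Specialisation k A ≃ₐ[k] A₀,
      ∀ x : D, e (specialisationMap k A (point x)) = point₀ x

/-- The algebra `k⟨G⟩⟦h⟧` of formal power series over the free algebra on a set `G`. -/
abbrev FreeFormalAlgebra (G : Type v) : Type (max u v) := (FreeAlgebra k G)⟦X⟧

instance (G : Type v) : Algebra k⟦X⟧ (FreeFormalAlgebra k G) :=
  RingHom.toAlgebra' (PowerSeries.map (algebraMap k (FreeAlgebra k G))) fun c x => by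
    ext m
    rw [coeff_mul, coeff_mul]
    refine Finset.sum_nbij' Prod.swap Prod.swap ?_ ?_ ?_ ?_ ?_ <;> rintro ⟨a, b⟩ hab
    · simpa [add_comm] using hab
    · simpa [add_comm] using hab
    · rfl
    · rfl
    · simp only [coeff_map, Prod.fst_swap, Prod.snd_swap]
      exact Algebra.commutes _ _

instance (G : Type v) : IsScalarTower k k⟦X⟧ (FreeFormalAlgebra k G) :=
  IsScalarTower.of_algebraMap_eq fun c => by
    rw [PowerSeries.algebraMap_apply, PowerSeries.algebraMap_apply]
    exact (PowerSeries.map_C (algebraMap k (FreeAlgebra k G)) c).symm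

variable {k}

/-- The `k⟦h⟧`-algebra topologically generated by a set `G` and subject to the relations `r = 0`
(`r ∈ rels`): the quotient of `k⟨G⟩⟦h⟧` by the closure of the two-sided ideal generated by
`rels`. -/
def TopPresented {G : Type v} (rels : Set (FreeFormalAlgebra k G)) : Type (max u v) :=
  (hClosure k (TwoSidedIdeal.span rels)).ringCon.Quotient

section
variable {G : Type v} (rels : Set (FreeFormalAlgebra k G))

instance : Ring (TopPresented rels) :=
  inferInstanceAs (Ring (hClosure k (TwoSidedIdeal.span rels)).ringCon.Quotient)

instance : Algebra k (TopPresented rels) :=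
  inferInstanceAs (Algebra k (hClosure k (TwoSidedIdeal.span rels)).ringCon.Quotient)

instance : Algebra k⟦X⟧ (TopPresented rels) :=
  inferInstanceAs (Algebra k⟦X⟧ (hClosure k (TwoSidedIdeal.span rels)).ringCon.Quotient)

/-- The projection from `k⟨G⟩⟦h⟧`. -/
def TopPresented.mk : FreeFormalAlgebra k G →ₐ[k⟦X⟧] TopPresented rels :=
  { (hClosure k (TwoSidedIdeal.span rels)).ringCon.mk' with commutes' := fun _ => rfl }

instance : IsScalarTower k k⟦X⟧ (TopPresented rels) :=
  IsScalarTower.of_algebraMap_eq fun c =>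
    congrArg (TopPresented.mk rels)
      (IsScalarTower.algebraMap_apply k k⟦X⟧ (FreeFormalAlgebra k G) c)

/-- The image of a generator. -/
def TopPresented.of (x : G) : TopPresented rels :=
  TopPresented.mk rels (PowerSeries.C (FreeAlgebra.ι k x))

lemma TopPresented.mk_eq_zero {r : FreeFormalAlgebra k G} (hr : r ∈ rels) :
    TopPresented.mk rels r = 0 := by
  have h : r ∈ hClosure k (TwoSidedIdeal.span rels) := by
    unfold hClosure
    rw [TwoSidedIdeal.mem_mk']
    exact fun m => ⟨r, TwoSidedIdeal.subset_span hr, 0, by simp⟩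
  exact (RingCon.eq _).2 ((TwoSidedIdeal.mem_iff _ _).1 h)

end

end algebra

/-! ### Root data -/

/-- Symmetrisable generalised Cartan matrices. -/
structure IsSymmetrisableGCM {I : Type*} (C : Matrix I I ℤ) : Prop where
  diag : ∀ i, C i i = 2
  nonpos : ∀ i j, i ≠ j → C i j ≤ 0
  zero_iff : ∀ i j, C i j = 0 ↔ C j i = 0
  symmetrisable : ∃ d : I → ℤ, (∀ i, 0 < d i) ∧ ∀ i j, d i * C i j = d j * C j i

/-- A root datum, `X`-regular and `Y`-regular, with Dynkin set `I` and lattices `Λ` (often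
written `X`) and `Y`, associated to a symmetrisable generalised Cartan matrix. -/
structure RootDatum (I Λ Y : Type*) [AddCommGroup Λ] [AddCommGroup Y] where
  cartan : Matrix I I ℤ
  isGCM : IsSymmetrisableGCM cartan
  pairing : Y →ₗ[ℤ] Λ →ₗ[ℤ] ℤ
  perfect : pairing.IsPerfPair
  root : I → Λ
  coroot : I → Y
  pairing_coroot_root : ∀ i j, pairing (coroot i) (root j) = cartan i j
  root_regular : LinearIndependent ℤ root
  coroot_regular : LinearIndependent ℤ coroot

/-- The generators `Xᵢ⁻`, `Xᵢ⁺` (`i ∈ I`) and `μ ∈ Y`. -/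
inductive Gen (I Y : Type*)
  | neg : I → Gen I Y
  | pos : I → Gen I Y
  | cartan : Y → Gen I Y

section KacMoody

variable {I Λ Y : Type*} [AddCommGroup Λ] [AddCommGroup Y] (R : RootDatum I Λ Y)

/-- The non-deformable relations, for elements `f g` (`g` a generator) of a Lie ring `L`, written
as a set of elements to be annihilated. The relations `add` say that `μ ↦ f μ` is a morphism of
`ℤ`-modules. -/
inductive NonDefRel {L : Type*} [LieRing L] (f : Gen I Y → L) : L → Prop
  | add (μ ν : Y) : NonDefRel f (f (.cartan (μ + ν)) - (f (.cartan μ) + f (.cartan ν)))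
  | comm (μ ν : Y) : NonDefRel f ⁅f (.cartan μ), f (.cartan ν)⁆
  | weight_pos (μ : Y) (i : I) :
      NonDefRel f (⁅f (.cartan μ), f (.pos i)⁆ - R.pairing μ (R.root i) • f (.pos i))
  | weight_neg (μ : Y) (i : I) :
      NonDefRel f (⁅f (.cartan μ), f (.neg i)⁆ - (-R.pairing μ (R.root i)) • f (.neg i))
  | pos_neg (i j : I) (hij : i ≠ j) : NonDefRel f ⁅f (.pos i), f (.neg j)⁆

variable {R} in
lemma NonDefRel.map {L L' : Type*} [LieRing L] [LieRing L'] {f : Gen I Y → L} {x : L}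
    (hx : NonDefRel R f x) (φ : L →+ L') (hφ : ∀ x y, φ ⁅x, y⁆ = ⁅φ x, φ y⁆) :
    NonDefRel R (φ ∘ f) (φ x) := by
  cases hx with
  | add μ ν => simpa using NonDefRel.add (R := R) (f := φ ∘ f) μ ν
  | comm μ ν => simpa [hφ] using NonDefRel.comm (R := R) (f := φ ∘ f) μ ν
  | weight_pos μ i => simpa [hφ] using NonDefRel.weight_pos (R := R) (f := φ ∘ f) μ i
  | weight_neg μ i => simpa [hφ] using NonDefRel.weight_neg (R := R) (f := φ ∘ f) μ i
  | pos_neg i j hij => simpa [hφ] using NonDefRel.pos_neg (R := R) (f := φ ∘ f) i j hij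

variable (k : Type u) [Field k]

/-- The ideal of the free Lie algebra generated by the non-deformable relations. -/
def idealF : LieIdeal k (FreeLieAlgebra k (Gen I Y)) :=
  LieSubmodule.lieSpan k _ {x | NonDefRel R (FreeLieAlgebra.of k) x}

/-- The ideal of the free Lie algebra generated by the non-deformable relations and by the
relations `[Xᵢ⁺, Xᵢ⁻] = αᵢ` (the simple coroot). -/
def idealTilde : LieIdeal k (FreeLieAlgebra k (Gen I Y)) :=
  LieSubmodule.lieSpan k _
    ({x | NonDefRel R (FreeLieAlgebra.of k) x} ∪
      Set.range fun i : I => ⁅FreeLieAlgebra.of k (Gen.pos i : Gen I Y),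
        FreeLieAlgebra.of k (Gen.neg i)⁆ - FreeLieAlgebra.of k (Gen.cartan (R.coroot i)))

/-- The Lie algebra `𝔤_F`: the same generators as `𝔤`, and only the non-deformable relations. -/
abbrev LieF : Type _ := FreeLieAlgebra k (Gen I Y) ⧸ idealF R k

/-- The Kac-Moody algebra without Serre relations `𝔤̃`. -/
abbrev LieTilde : Type _ := FreeLieAlgebra k (Gen I Y) ⧸ idealTilde R k

/-- A morphism from the free Lie algebra which annihilates the non-deformable relations induces a
morphism from `𝔤_F`. -/
def LieF.lift {L : Type*} [LieRing L] [LieAlgebra k L] (φ : FreeLieAlgebra k (Gen I Y) →ₗ⁅k⁆ L)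
    (hφ : ∀ x, NonDefRel R (FreeLieAlgebra.of k) x → φ x = 0) : LieF R k →ₗ⁅k⁆ L :=
  have hle : idealF R k ≤ φ.ker :=
    LieSubmodule.lieSpan_le.2 fun x hx => (LieHom.mem_ker).2 (hφ x hx)
  { (idealF R k).toSubmodule.liftQ (φ : FreeLieAlgebra k (Gen I Y) →ₗ[k] L)
      (fun _ hx => LieHom.mem_ker.1 (hle hx)) with
    map_lie' := by
      intro x y
      induction x using Submodule.Quotient.induction_on with | H x => ?_
      induction y using Submodule.Quotient.induction_on with | H y => ?_
      exact φ.map_lie x y }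

/-- The projection from `𝔤_F` to `𝔤̃`. -/
def LieF.toTilde : LieF R k →ₗ⁅k⁆ LieTilde R k :=
  LieF.lift R k
    { ((idealTilde R k).toSubmodule.mkQ :
        FreeLieAlgebra k (Gen I Y) →ₗ[k] LieTilde R k) with map_lie' := rfl }
    (fun _ hx => (Submodule.Quotient.mk_eq_zero _).2
      (LieSubmodule.subset_lieSpan (Set.mem_union_left _ hx)))

/-- The universal enveloping algebra `U(𝔤_F)`. -/
abbrev UF : Type _ := UniversalEnvelopingAlgebra k (LieF R k)

/-- The universal enveloping algebra `U(𝔤̃)`. -/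
abbrev UTilde : Type _ := UniversalEnvelopingAlgebra k (LieTilde R k)

/-- `U(𝔤̃)` as a `𝔤_F`-pointed algebra: the projection from `U(𝔤_F)`. -/
def UTilde.point : UF R k →ₐ[k] UTilde R k :=
  UniversalEnvelopingAlgebra.lift k
    ((UniversalEnvelopingAlgebra.ι k).comp (LieF.toTilde R k))

end KacMoody

/-! ### Colourings and GQE equations -/

/-- The set `[E]` of pairs `(n, l)` of positive integers with `l ≤ n`. -/
abbrev Edge : Type := {e : ℕ × ℕ // 1 ≤ e.2 ∧ e.2 ≤ e.1}

variable (k : Type u) [Field k]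

/-- A colouring, with values in `k⟦h⟧`, of the global crystal of rank 1, whose edges form two
copies of `[E]`. -/
structure Colouring where
  neg : Edge → k⟦X⟧
  pos : Edge → k⟦X⟧

variable {k}

/-- The congruence class `[ψ](n, l) = ψ⁻(n, l) ψ⁺(n, n - l + 1)` for `1 ≤ l ≤ n`
(and zero elsewhere, where it is never used). -/
def Colouring.bracket (ψ : Colouring k) (n l : ℕ) : k⟦X⟧ :=
  if h : 1 ≤ l ∧ l ≤ n then ψ.neg ⟨(n, l), h⟩ * ψ.pos ⟨(n, n - l + 1), by simp; omega⟩ else 0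

/-- The value at `(a, b) ∈ ℤ²` of an element of `k[u, v]⟦h⟧`. -/
def evalPair (P : (MvPolynomial (Fin 2) k)⟦X⟧) (a b : ℤ) : k⟦X⟧ :=
  PowerSeries.map (MvPolynomial.eval ![(a : k), (b : k)]) P

/-- The value at `a ∈ ℤ` of an element of `k[u]⟦h⟧`. -/
def evalOne (P : (Polynomial k)⟦X⟧) (a : ℤ) : k⟦X⟧ :=
  PowerSeries.map (Polynomial.evalRingHom (a : k)) P

/-- `h`-admissible colourings. By regularity, `[ψ]` is given by an element `P` of `k[u, v]⟦h⟧`,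
necessarily unique in characteristic zero, and the last two axioms are about the values of `P`
outside of `[E]`. -/
def Colouring.IsHAdmissible (ψ : Colouring k) : Prop :=
  (∀ n l : ℕ, 1 ≤ l → l ≤ n →
    constantCoeff (ψ.bracket n l) = (l : k) * ((n : k) - (l : k) + 1)) ∧
  ∃ P : (MvPolynomial (Fin 2) k)⟦X⟧,
    (∀ n l : ℕ, 1 ≤ l → l ≤ n → ψ.bracket n l = evalPair P n l) ∧
    (∀ n : ℕ, evalPair P n (n + 1) = 0) ∧
    (∀ n l : ℕ, 1 ≤ n → 1 ≤ l → evalPair P (-n - 2) l = evalPair P n (n + l + 1))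

variable (k) in
/-- Sequences with values in `k[u]⟦h⟧` which converge to zero for the `h`-adic topology. -/
def NullSequence : Type u :=
  {M : ℕ → (Polynomial k)⟦X⟧ //
    ∀ m : ℕ, ∃ p₀ : ℕ, ∀ p ≥ p₀, (X : (Polynomial k)⟦X⟧) ^ m ∣ M p}

/-- The entry `T(ψ)_{p,a}`, applied to a function `f : ℤ → k⟦h⟧`. The quotient
`[ψ](n,p)! / [ψ](n,p-a)!` is the product of the `[ψ](n,l)` for `p - a < l ≤ p`. -/
def gqeT (ψ : Colouring k) (p a : ℕ) (f : ℤ → k⟦X⟧) (n : ℤ) : k⟦X⟧ :=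
  if a ≤ p ∧ (p : ℤ) ≤ n then
    (∏ l ∈ Finset.Ioc (p - a) p, ψ.bracket n.toNat l) * f (n - 2 * p + 2 * a)
  else 0

/-- The entry `N(ψ)_p`, a function `ℤ → k⟦h⟧`. -/
def gqeN (ψ : Colouring k) (p : ℕ) (n : ℤ) : k⟦X⟧ :=
  if 0 < p ∧ (p : ℤ) ≤ n then ψ.bracket n.toNat p else 0

/-- `M` is a solution of the GQE equation `T(ψ₁) M = N(ψ₂)[d]` of degree `d`, where
`N[d]_p = N_{p-d}` if `p ≥ d` and `N[d]_p = 0` otherwise. -/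
def IsGQESolution (ψ₁ ψ₂ : Colouring k) (d : ℤ) (M : NullSequence k) : Prop :=
  ∀ (p : ℕ) (n : ℤ),
    ∑ a ∈ Finset.range (p + 1), gqeT ψ₁ p a (evalOne (M.1 a)) n =
      if d ≤ p then gqeN ψ₂ ((p : ℤ) - d).toNat n else 0

/-! ### GQE algebras without Serre relations -/

section Uth

variable {I Λ Y : Type*} [AddCommGroup Λ] [AddCommGroup Y] (R : RootDatum I Λ Y)

variable (k) in
/-- The generators, as elements of `k⟨G⟩⟦h⟧`. -/
def gen (g : Gen I Y) : FreeFormalAlgebra k (Gen I Y) := PowerSeries.C (FreeAlgebra.ι k g)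

/-- The convergent series `∑ₐ (Xᵢ⁻)ᵃ Mₐ(αᵢ) (Xᵢ⁺)ᵃ`, where `αᵢ` is the simple coroot. Its
coefficient at `hᵐ` is a sum with finitely many nonzero terms, since `M` converges to zero. -/
def gqeSeries (M : NullSequence k) (i : I) : FreeFormalAlgebra k (Gen I Y) :=
  PowerSeries.mk fun m => ∑ᶠ a : ℕ,
    FreeAlgebra.ι k (Gen.neg i : Gen I Y) ^ a *
      Polynomial.aeval (FreeAlgebra.ι k (Gen.cartan (R.coroot i) : Gen I Y)) (coeff m (M.1 a)) *
      FreeAlgebra.ι k (Gen.pos i) ^ a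

/-- The defining relations of `Ũ_h`: the non-deformable relations, and
`Xᵢ⁺ Xᵢ⁻ = ∑ₐ (Xᵢ⁻)ᵃ S_{i,a}(αᵢ) (Xᵢ⁺)ᵃ` for `i ∈ I`. -/
def relTilde (S : I → NullSequence k) : Set (FreeFormalAlgebra k (Gen I Y)) :=
  {x | NonDefRel R (gen k) x} ∪
    Set.range fun i : I => gen k (.pos i) * gen k (.neg i) - gqeSeries R (S i) i

/-- The algebra `Ũ_h` attached to a family `S` of sequences; for `S` the family of solutions of the
GQE equations `T(ψᵢ) M = N(ψᵢ)[-1]` it is the GQE algebra without Serre relations `Ũ_h(𝔤, ψ)`. -/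
abbrev UhTilde (S : I → NullSequence k) : Type _ := TopPresented (relTilde R S)

/-- `Ũ_h` as a `𝔤_F`-pointed algebra: the morphism from `U(𝔤_F)` which sends each generator
to the generator with the same name. -/
def UhTilde.point (S : I → NullSequence k) : UF R k →ₐ[k] UhTilde R S :=
  UniversalEnvelopingAlgebra.lift k
    (LieF.lift R k (FreeLieAlgebra.lift k (TopPresented.of (relTilde R S))) (by
      intro x hx
      let φ := FreeLieAlgebra.lift k (gen k : Gen I Y → FreeFormalAlgebra k (Gen I Y))
      let π := (TopPresented.mk (relTilde R S)).restrictScalars k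
      have h1 : FreeLieAlgebra.lift k (TopPresented.of (relTilde R S)) =
          (π : FreeFormalAlgebra k (Gen I Y) →ₗ⁅k⁆ TopPresented (relTilde R S)).comp φ := by
        refine FreeLieAlgebra.hom_ext fun g => ?_
        rw [FreeLieAlgebra.lift_of_apply, LieHom.comp_apply, FreeLieAlgebra.lift_of_apply]
        rfl
      have h2 : NonDefRel R (gen k) (φ x) := by
        have h3 := hx.map (φ : FreeLieAlgebra k (Gen I Y) →+ FreeFormalAlgebra k (Gen I Y))
          φ.map_lie
        have h4 : (φ : FreeLieAlgebra k (Gen I Y) →+ FreeFormalAlgebra k (Gen I Y)) ∘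
            FreeLieAlgebra.of k = gen k := FreeLieAlgebra.of_comp_lift _
        rw [h4] at h3
        exact h3
      rw [h1]
      exact TopPresented.mk_eq_zero _ (Set.mem_union_left _ h2)))

end Uth

end GQE

end

/-! Part 1. By density, the symmetry axiom makes `[ψ](u, v)` invariant under the involution `(u, v)
↦ (-u - 2, v - u - 1)`. Hence it is a power series in `h` over `k[w, c]`, where `w = u - 2v` and `c
= v(u - v + 1)` generate the invariants, and its constant term is `c`. In the GQE equation the
unknown `S_a` is evaluated at `w + 2a`, with `w = n - 2p`. The equation thus asks for the expansion
of `[ψ](u, v + 1)`, with coefficients depending on `w` only, in the products `B_a = ∏_{j<a} [ψ](u, v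
- j)` (`descProd`). At `h = 0` the product `B_a` is monic of degree `a` in `c`, so the expansion
exists, with finitely many terms at each order in `h`; this finiteness is the convergence of `S` to
zero. At `v = p` the terms with `a > p` vanish because `[ψ](n, 0) = 0`, which is the mirror image of
`[ψ](n, n + 1) = 0`. Uniqueness holds because the system is triangular with nonzero diagonal entries
(`triangular_eq_zero`); the same argument at `h = 0` shows that `S` specialises to `(u, 1, 0, …)`.

Part 2. Modulo `h` the deformed relation is therefore `[Xᵢ⁺, Xᵢ⁻] = αᵢ`, and universal properties
identify the specialisation with `U(𝔤̃)` (`exists_specialisation_equiv`). For topological freeness,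
the model is `Induced`, the tensor product of the free algebra on the `Xᵢ⁻` with the Borel algebra,
mapped to `Ũ_h` by normal forms.

Surjectivity (`formalNormalForm_surjective`): normal forms span at `h = 0`, and successive
approximation lifts this to all orders, since the closed ideal makes `Ũ_h` separated. Injectivity
(`formalNormalForm_eq_zero`): `Ũ_h` acts on `Induced⟦h⟧` as on a module induced from the Borel
algebra. The deformed relation expresses `Xᵢ⁺ Xᵢ⁻` as `Xᵢ⁻ Xᵢ⁺` plus a correction whose coefficient
at `hⁿ` involves only the coefficients of `Xᵢ⁺` of order less than `n`; so the operator `Xᵢ⁺` is the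
fixed point of a contraction (`exists_posOp`). The normal form of `v`, applied to `1 ⊗ 1`, gives
back `v`. No PBW theorem for `U(𝔤̃)` is needed. -/

noncomputable section

namespace GQE

open PowerSeries

attribute [local instance 100] LieRing.ofAssociativeRing

/-! ### Part 1: existence, uniqueness and classical limit of the solution -/

section gqeEquation

variable {k : Type*} [Field k]

/-! ### Functions which are polynomial in each of two variables -/

/-- Functions `k × k → k` which are polynomial in each variable separately. -/
def IsSeparatelyPolynomial (f : k → k → k) : Prop :=
  (∀ y, ∃ r : Polynomial k, ∀ x, r.eval x = f x y) ∧
    ∀ x, ∃ r : Polynomial k, ∀ y, r.eval y = f x y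

lemma polynomial_eq_zero_of_eval_natCast [CharZero k] {r : Polynomial k} (N : ℕ)
    (h : ∀ n : ℕ, N ≤ n → r.eval (n : k) = 0) : r = 0 := by
  refine Polynomial.eq_zero_of_infinite_isRoot _ ?_
  refine ((Set.Ici_infinite N).image (f := (Nat.cast : ℕ → k))
    Nat.cast_injective.injOn).mono ?_
  rintro _ ⟨n, hn, rfl⟩
  exact h n hn

/-- Zariski density, one variable at a time: first in `y` for each large integer `x`, then in `x`.
This is why the bound on `q` may depend on `n`. -/
lemma IsSeparatelyPolynomial.eq_zero [CharZero k] {f : k → k → k}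
    (hf : IsSeparatelyPolynomial f) (N : ℕ) (M : ℕ → ℕ)
    (h : ∀ n q : ℕ, N ≤ n → M n ≤ q → f n q = 0) (x y : k) : f x y = 0 := by
  have h1 : ∀ n : ℕ, N ≤ n → ∀ y, f n y = 0 := by
    intro n hn y
    obtain ⟨r, hr⟩ := hf.2 n
    have : r = 0 := polynomial_eq_zero_of_eval_natCast (M n) fun q hq => by
      rw [hr, h n q hn hq]
    rw [← hr, this, Polynomial.eval_zero]
  obtain ⟨r, hr⟩ := hf.1 y
  have : r = 0 := polynomial_eq_zero_of_eval_natCast N fun n hn => by rw [hr, h1 n hn]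
  rw [← hr, this, Polynomial.eval_zero]

lemma IsSeparatelyPolynomial.swap {f : k → k → k} (hf : IsSeparatelyPolynomial f) :
    IsSeparatelyPolynomial fun x y => f y x := ⟨hf.2, hf.1⟩

lemma IsSeparatelyPolynomial.sub {f g : k → k → k} (hf : IsSeparatelyPolynomial f)
    (hg : IsSeparatelyPolynomial g) : IsSeparatelyPolynomial fun x y => f x y - g x y := by
  constructor
  · intro y
    obtain ⟨r, hr⟩ := hf.1 y
    obtain ⟨s, hs⟩ := hg.1 y
    exact ⟨r - s, fun x => by rw [Polynomial.eval_sub, hr, hs]⟩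
  · intro y
    obtain ⟨r, hr⟩ := hf.2 y
    obtain ⟨s, hs⟩ := hg.2 y
    exact ⟨r - s, fun x => by rw [Polynomial.eval_sub, hr, hs]⟩

lemma exists_eval_eq_mvPolynomial (f : MvPolynomial (Fin 2) k) (p q : Polynomial k) :
    ∃ r : Polynomial k, ∀ x, r.eval x = MvPolynomial.eval ![p.eval x, q.eval x] f := by
  refine ⟨MvPolynomial.aeval ![p, q] f, fun x => ?_⟩
  induction f using MvPolynomial.induction_on with
  | C a => simp
  | add a b ha hb => rw [map_add, Polynomial.eval_add, ha, hb, map_add]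
  | mul_X a i ha =>
    rw [map_mul, Polynomial.eval_mul, ha, map_mul]
    fin_cases i <;> simp

lemma exists_eval_eq_evalEval (f : Polynomial (Polynomial k)) (p q : Polynomial k) :
    ∃ r : Polynomial k, ∀ x, r.eval x = f.evalEval (p.eval x) (q.eval x) := by
  refine ⟨f.eval₂ (Polynomial.compRingHom p) q, fun x => ?_⟩
  induction f using Polynomial.induction_on' with
  | add a b ha hb => rw [Polynomial.eval₂_add, Polynomial.eval_add, ha, hb, Polynomial.evalEval_add]
  | monomial n a =>
    rw [Polynomial.eval₂_monomial]
    simp [Polynomial.evalEval]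

lemma isSeparatelyPolynomial_mvPolynomial (f : MvPolynomial (Fin 2) k) :
    IsSeparatelyPolynomial fun x y => MvPolynomial.eval ![x, y] f := by
  constructor
  · intro y
    simpa using exists_eval_eq_mvPolynomial f Polynomial.X (Polynomial.C y)
  · intro x
    simpa using exists_eval_eq_mvPolynomial f (Polynomial.C x) Polynomial.X

/-- The value of `f(w, c)` at `w = x - 2y`, `c = y(x - y + 1)`; these are the invariants of the
involution `(x, y) ↦ (-x - 2, y - x - 1)`. -/
def evalInv (x y : k) : Polynomial (Polynomial k) →+* k :=
  Polynomial.evalEvalRingHom (x - 2 * y) (y * (x - y + 1))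

lemma isSeparatelyPolynomial_evalInv (f : Polynomial (Polynomial k)) :
    IsSeparatelyPolynomial fun x y => evalInv x y f := by
  constructor
  · intro y
    obtain ⟨r, hr⟩ := exists_eval_eq_evalEval f
      (Polynomial.X - 2 * Polynomial.C y) (Polynomial.C y * (Polynomial.X - Polynomial.C y + 1))
    refine ⟨r, fun x => (hr x).trans ?_⟩
    change _ = f.evalEval _ _
    congr 1 <;> simp
  · intro x
    obtain ⟨r, hr⟩ := exists_eval_eq_evalEval f
      (Polynomial.C x - 2 * Polynomial.X) (Polynomial.X * (Polynomial.C x - Polynomial.X + 1))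
    refine ⟨r, fun y => (hr y).trans ?_⟩
    change _ = f.evalEval _ _
    congr 1 <;> simp

lemma evalInv_X (x y : k) : evalInv x y Polynomial.X = y * (x - y + 1) := by
  simp [evalInv]

lemma evalInv_C (x y : k) (f : Polynomial k) :
    evalInv x y (Polynomial.C f) = f.eval (x - 2 * y) := by
  simp [evalInv]

/-- The ring `k[x, y]` is generated by `1` and `y` as a module over `k[w, c]`, because `x = w + 2y`
and `y² = c - (w + 1) y`. -/
lemma exists_invariant_decomposition (f : MvPolynomial (Fin 2) k) :
    ∃ a b : Polynomial (Polynomial k), ∀ x y : k,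
      MvPolynomial.eval ![x, y] f = evalInv x y a + y * evalInv x y b := by
  induction f using MvPolynomial.induction_on with
  | C a => exact ⟨Polynomial.C (Polynomial.C a), 0, fun x y => by simp [evalInv_C]⟩
  | add f g hf hg =>
    obtain ⟨a, b, h⟩ := hf
    obtain ⟨a', b', h'⟩ := hg
    exact ⟨a + a', b + b', fun x y => by rw [map_add, h, h', map_add, map_add]; ring⟩
  | mul_X f i hf =>
    obtain ⟨a, b, h⟩ := hf
    fin_cases i
    · refine ⟨Polynomial.C Polynomial.X * a + 2 * Polynomial.X * b,
        2 * a + Polynomial.C Polynomial.X * b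
          - 2 * (Polynomial.C Polynomial.X + 1) * b, fun x y => ?_⟩
      rw [map_mul, h]
      simp only [map_add, map_sub, map_mul, evalInv_C, evalInv_X, map_ofNat, map_one,
        Polynomial.eval_X]
      simp
      ring
    · refine ⟨Polynomial.X * b, a - (Polynomial.C Polynomial.X + 1) * b, fun x y => ?_⟩
      rw [map_mul, h]
      simp only [map_add, map_sub, map_mul, evalInv_C, evalInv_X, map_one,
        Polynomial.eval_X]
      simp
      ring

/-- Write `f = a + y b` with `a`, `b` invariant. The involution moves `y` by `n + 1` at `(n, n + l +
1)`, so the symmetry of `f` forces `(n + 1) b = 0` there. -/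
lemma exists_invariant [CharZero k] (f : MvPolynomial (Fin 2) k)
    (hf : ∀ n l : ℕ, 1 ≤ n → 1 ≤ l →
      MvPolynomial.eval ![-(n : k) - 2, (l : k)] f = MvPolynomial.eval ![(n : k), n + l + 1] f) :
    ∃ a : Polynomial (Polynomial k), ∀ x y : k, MvPolynomial.eval ![x, y] f = evalInv x y a := by
  obtain ⟨a, b, h⟩ := exists_invariant_decomposition f
  have hb : ∀ x y, evalInv x y b = 0 := by
    -- The points `(n, n + l + 1)` with `n, l ≥ 1` are those with second coordinate at least `n +
    -- 2`.
    refine (isSeparatelyPolynomial_evalInv b).eq_zero 1 (fun n => n + 2) fun n q hn hq => ?_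
    obtain ⟨l, rfl⟩ : ∃ l, q = n + l + 1 := ⟨q - n - 1, by omega⟩
    have h1 := hf n l hn (by omega)
    have e : evalInv (-(n : k) - 2) (l : k) = evalInv (n : k) (n + l + 1) := by
      unfold evalInv
      congr 1 <;> ring
    rw [h, h, e] at h1
    have h2 : ((n + 1 : ℕ) : k) * evalInv (n : k) (n + l + 1) b = 0 := by
      push_cast
      linear_combination -h1
    push_cast
    exact (mul_eq_zero.1 h2).resolve_left (Nat.cast_ne_zero.2 (by omega))
  exact ⟨a, fun x y => by rw [h, hb]; ring⟩

/-! ### The topological basis -/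

/-- The shift `y ↦ y - j`, in the coordinates `w = x - 2y`, `c = y(x - y + 1)`. -/
def shiftInv (j : k) : Polynomial (Polynomial k) →+* Polynomial (Polynomial k) :=
  Polynomial.eval₂RingHom
    (Polynomial.C.comp (Polynomial.compRingHom (Polynomial.X + Polynomial.C (2 * j))))
    (Polynomial.X - Polynomial.C (Polynomial.C j * (Polynomial.X + Polynomial.C (j + 1))))

lemma evalInv_shiftInv (x y j : k) (f : Polynomial (Polynomial k)) :
    evalInv x y (shiftInv j f) = evalInv x (y - j) f := by
  have : (evalInv x y).comp (shiftInv j) = evalInv x (y - j) := by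
    refine Polynomial.ringHom_ext' (Polynomial.ringHom_ext ?_ ?_) ?_
    · intro a
      simp [shiftInv, evalInv]
    · simp [shiftInv, evalInv]
      ring
    · simp [shiftInv, evalInv]
      ring
  exact congrArg (fun φ => φ f) this

/-! ### Triangular systems and expansions in a topological basis -/

section linear

variable {M N : Type*} [AddCommGroup M] [AddCommGroup N]

/-- The recursive solution of a triangular system `∑_{i+j=m} Φⱼ(Dᵢ) = Gₘ`. -/
def triangularSolution (Φ : ℕ → N →+ M) (h : Function.Surjective (Φ 0)) (G : ℕ → M) : ℕ → N
  | m => Function.surjInv h (G m - ∑ i : Fin m, Φ (m - i) (triangularSolution Φ h G i))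
decreasing_by exact i.2

lemma triangularSolution_spec (Φ : ℕ → N →+ M) (h : Function.Surjective (Φ 0)) (G : ℕ → M)
    (m : ℕ) : ∑ ij ∈ Finset.HasAntidiagonal.antidiagonal m,
      Φ ij.2 (triangularSolution Φ h G ij.1) = G m := by
  rw [Finset.Nat.sum_antidiagonal_eq_sum_range_succ_mk, Finset.sum_range_succ, Nat.sub_self]
  have : Φ 0 (triangularSolution Φ h G m) =
      G m - ∑ i : Fin m, Φ (m - i) (triangularSolution Φ h G i) := by
    rw [triangularSolution]
    exact Function.surjInv_eq h _
  rw [this, Finset.sum_range]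
  abel

end linear

lemma exists_monic_expansion {A : Type*} [CommRing A] [Nontrivial A] (b : ℕ → Polynomial A)
    (hb : ∀ a, (b a).Monic) (hd : ∀ a, (b a).natDegree = a) :
    Function.Surjective (Finsupp.linearCombination A b) := by
  let S : Polynomial.Sequence A :=
    { elems' := b
      degree_eq' := fun i => by
        rw [Polynomial.degree_eq_natDegree (hb i).ne_zero, hd] }
  have := S.span fun i => by
    change IsUnit (b i).leadingCoeff
    rw [hb i]
    exact isUnit_one
  intro f
  have hf : f ∈ Submodule.span A (Set.range b) := by
    change f ∈ Submodule.span A (Set.range S)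
    rw [this]
    trivial
  exact Finsupp.mem_span_range_iff_exists_finsupp.1 hf

/-- If the constant terms of a sequence of power series over `A[c]` are monic of degrees
`0, 1, 2, …`, then the sequence is a topological basis; here, existence of expansions. -/
lemma exists_topological_expansion {A : Type*} [CommRing A] [Nontrivial A]
    (B : ℕ → (Polynomial A)⟦X⟧) (hb : ∀ a, (constantCoeff (B a)).Monic)
    (hd : ∀ a, (constantCoeff (B a)).natDegree = a) (G : (Polynomial A)⟦X⟧) :
    ∃ D : ℕ → ℕ →₀ A, ∀ m, ∑ ij ∈ Finset.HasAntidiagonal.antidiagonal m,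
      (D ij.1).sum (fun a d => Polynomial.C d * coeff ij.2 (B a)) = coeff m G := by
  let Φ : ℕ → (ℕ →₀ A) →+ Polynomial A := fun j =>
    (Finsupp.linearCombination A fun a => coeff j (B a)).toAddMonoidHom
  have hΦ : Function.Surjective (Φ 0) := by
    have := exists_monic_expansion (fun a => coeff 0 (B a)) (by simpa using hb) (by simpa using hd)
    exact this
  refine ⟨triangularSolution Φ hΦ fun m => coeff m G, fun m => ?_⟩
  rw [← triangularSolution_spec Φ hΦ (fun m => coeff m G) m]
  refine Finset.sum_congr rfl fun ij _ => ?_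
  change _ = Finsupp.linearCombination A _ _
  rw [Finsupp.linearCombination_apply]
  simp [Polynomial.smul_eq_C_mul]

/-! ### The GQE equation of degree `-1` -/

/-- The series `∏_{j<a} [ψ](u, v - j)`, in the coordinates `w`, `c`. -/
def descProd (Q : (Polynomial (Polynomial k))⟦X⟧) (a : ℕ) : (Polynomial (Polynomial k))⟦X⟧ :=
  ∏ j ∈ Finset.range a, PowerSeries.map (shiftInv (j : k)) Q

lemma map_evalInv_descProd (Q : (Polynomial (Polynomial k))⟦X⟧) (a : ℕ) (x y : k) :
    PowerSeries.map (evalInv x y) (descProd Q a) =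
      ∏ j ∈ Finset.range a, PowerSeries.map (evalInv x (y - j)) Q := by
  rw [descProd, map_prod]
  refine Finset.prod_congr rfl fun j _ => ?_
  ext m
  simp [evalInv_shiftInv]

/-- The shift by `j` sends `c` to `c - j(w + j + 1)`, which is monic of degree one in `c` over
`k[w]`. This makes the products a topological basis. -/
lemma constantCoeff_descProd {Q : (Polynomial (Polynomial k))⟦X⟧}
    (hQ : constantCoeff Q = Polynomial.X) (a : ℕ) :
    (constantCoeff (descProd Q a)).Monic ∧ (constantCoeff (descProd Q a)).natDegree = a := by
  have h1 : constantCoeff (descProd Q a) = ∏ j ∈ Finset.range a,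
      (Polynomial.X - Polynomial.C (Polynomial.C (j : k) *
        (Polynomial.X + Polynomial.C ((j : k) + 1)))) := by
    rw [descProd, map_prod]
    refine Finset.prod_congr rfl fun j _ => ?_
    rw [← coeff_zero_eq_constantCoeff_apply, coeff_map, coeff_zero_eq_constantCoeff_apply, hQ]
    simp [shiftInv]
  rw [h1]
  constructor
  · exact Polynomial.monic_prod_of_monic _ _ fun j _ => Polynomial.monic_X_sub_C _
  · rw [Polynomial.natDegree_prod_of_monic _ _ fun j _ => Polynomial.monic_X_sub_C _]
    simp [-map_mul, -map_add]

/-- For an admissible colouring, `[ψ](u, v)` is a power series in `h` over `k[w, c]`. -/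
lemma Colouring.IsHAdmissible.exists_invariant [CharZero k] {ψ : Colouring k}
    (hψ : ψ.IsHAdmissible) :
    ∃ Q : (Polynomial (Polynomial k))⟦X⟧, constantCoeff Q = Polynomial.X ∧
      (∀ n l : ℕ, 1 ≤ l → l ≤ n →
        ψ.bracket n l = PowerSeries.map (evalInv (n : k) (l : k)) Q) ∧
      (∀ n : ℕ, PowerSeries.map (evalInv (n : k) ((n : k) + 1)) Q = 0) ∧
      ∀ n : ℕ, PowerSeries.map (evalInv (n : k) 0) Q = 0 := by
  obtain ⟨h0, P, hP, hP1, hP2⟩ := hψ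
  have h1 : ∀ m, ∃ a : Polynomial (Polynomial k), (m = 0 → a = Polynomial.X) ∧
      ∀ x y, MvPolynomial.eval ![x, y] (coeff m P) = evalInv x y a := by
    intro m
    rcases Nat.eq_zero_or_pos m with rfl | hm
    · refine ⟨Polynomial.X, fun _ => rfl, fun x y => ?_⟩
      -- At order zero the congruence modulo `h` identifies the coefficient with `c`. The variables
      -- are swapped because the congruence is known for `n ≥ l`, a bound on `n` depending on `l`.
      refine sub_eq_zero.1 (((isSeparatelyPolynomial_mvPolynomial (coeff 0 P)).sub
        (isSeparatelyPolynomial_evalInv Polynomial.X)).swap.eq_zero 1 (fun n => n)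
        (fun l n hl hn => ?_) y x)
      have := h0 n l hl hn
      rw [hP n l hl hn, ← coeff_zero_eq_constantCoeff_apply, evalPair, coeff_map] at this
      push_cast at this
      rw [this, evalInv_X, sub_self]
    · obtain ⟨a, ha⟩ := GQE.exists_invariant (coeff m P) fun n l hn hl => by
        have := congrArg (coeff m) (hP2 n l hn hl)
        simpa [evalPair] using this
      exact ⟨a, fun h => absurd h hm.ne', ha⟩
  choose a ha0 ha using h1
  have hQ : ∀ x y : ℤ, evalPair P x y = PowerSeries.map (evalInv (x : k) (y : k))
      (PowerSeries.mk a) := by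
    intro x y
    ext m
    rw [evalPair, coeff_map, ha, coeff_map, coeff_mk]
  have hdiag : ∀ n : ℕ, PowerSeries.map (evalInv (n : k) ((n : k) + 1)) (PowerSeries.mk a) = 0 := by
    intro n
    have := hP1 n
    rw [hQ] at this
    exact_mod_cast this
  refine ⟨PowerSeries.mk a, ?_, ?_, hdiag, ?_⟩
  · rw [← coeff_zero_eq_constantCoeff_apply, coeff_mk, ha0 0 rfl]
  · intro n l hl hn
    rw [hP n l hl hn, hQ]
    simp
  · intro n
    ext m
    -- In the coordinates `(w, c)`, the point `(n, n + 1)` is `(-n - 2, 0)` and the point `(n, 0)`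
    -- is `(n, 0)`. The polynomial `a_m(-x - 2, 0)` vanishes at all natural `x`, hence also at `x =
    -- -n - 2`.
    obtain ⟨r, hr⟩ := exists_eval_eq_evalEval (a m) (-Polynomial.X - 2) 0
    have hr0 : r = 0 := polynomial_eq_zero_of_eval_natCast 0 fun n _ => by
      have := congrArg (coeff m) (hdiag n)
      rw [hr]
      rw [coeff_map, coeff_mk, map_zero, evalInv, Polynomial.coe_evalEvalRingHom] at this
      rw [← this]
      simp
      congr 1
      ring
    have := hr (-(n : k) - 2)
    rw [hr0] at this
    rw [coeff_map, coeff_mk, evalInv, Polynomial.coe_evalEvalRingHom, map_zero]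
    simpa using this.symm

lemma coeff_evalOne (f : (Polynomial k)⟦X⟧) (z : ℤ) (m : ℕ) :
    coeff m (evalOne f z) = (coeff m f).eval (z : k) := by
  rw [evalOne, coeff_map, Polynomial.coe_evalRingHom]

lemma evalOne_sub (f g : (Polynomial k)⟦X⟧) (z : ℤ) :
    evalOne (f - g) z = evalOne f z - evalOne g z := map_sub _ _ _

lemma eq_zero_of_evalOne_natCast [CharZero k] {f : (Polynomial k)⟦X⟧} (N : ℕ)
    (h : ∀ n : ℕ, N ≤ n → evalOne f n = 0) : f = 0 := by
  ext1 m
  refine polynomial_eq_zero_of_eval_natCast N fun n hn => ?_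
  have := congrArg (coeff m) (h n hn)
  rwa [coeff_evalOne, map_zero, Int.cast_natCast] at this

/-- Uniqueness for the triangular system given by the matrix `T(ψ)`. -/
lemma triangular_eq_zero {A : Type*} [CommRing A] [IsDomain A] (g : ℕ → ℕ → A)
    (hg : ∀ n l, 1 ≤ l → l ≤ n → g n l ≠ 0) (D : ℕ → ℤ → A)
    (hD : ∀ a N, (∀ n : ℕ, N ≤ n → D a n = 0) → ∀ z, D a z = 0)
    (h : ∀ p n : ℕ, p ≤ n → ∑ a ∈ Finset.range (p + 1),
      (∏ l ∈ Finset.Ioc (p - a) p, g n l) * D a (n - 2 * p + 2 * a) = 0) (a : ℕ) (z : ℤ) :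
    D a z = 0 := by
  induction a using Nat.strong_induction_on generalizing z with
  | _ a ih =>
    -- In the row `p = a` the last unknown is evaluated at `n - 2a + 2a = n`, and its coefficient is
    -- nonzero for `n ≥ a`.
    refine hD a a (fun n hn => ?_) z
    have h1 := h a n hn
    rw [Finset.sum_range_succ, Finset.sum_eq_zero fun b hb => by
      rw [ih b (Finset.mem_range.1 hb), mul_zero], zero_add, Nat.sub_self, sub_add_cancel] at h1
    refine (mul_eq_zero.1 h1).resolve_left (Finset.prod_ne_zero_iff.2 fun l hl => ?_)
    rw [Finset.mem_Ioc] at hl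
    exact hg n l hl.1 (hl.2.trans hn)

/-- The rows with `n < p` read `0 = 0`, and the degree `-1` replaces the index `p` of `N` by `p +
1`. -/
lemma isGQESolution_iff (ψ : Colouring k) (M : NullSequence k) :
    IsGQESolution ψ ψ (-1) M ↔ ∀ p n : ℕ, p ≤ n → ∑ a ∈ Finset.range (p + 1),
      (∏ l ∈ Finset.Ioc (p - a) p, ψ.bracket n l) * evalOne (M.1 a) (n - 2 * p + 2 * a) =
        if p + 1 ≤ n then ψ.bracket n (p + 1) else 0 := by
  have hp : ∀ p : ℕ, ((p : ℤ) - (-1)).toNat = p + 1 := fun p => by omega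
  constructor
  · intro h p n hpn
    have h1 := h p n
    rw [if_pos (by omega), hp, gqeN] at h1
    rw [Finset.sum_congr rfl fun a ha => by
      rw [gqeT, if_pos ⟨by simpa [Nat.lt_succ_iff] using ha, by exact_mod_cast hpn⟩,
        Int.toNat_natCast]] at h1
    rw [h1]
    by_cases hn : p + 1 ≤ n
    · rw [if_pos ⟨by omega, by exact_mod_cast hn⟩, if_pos hn, Int.toNat_natCast]
    · rw [if_neg fun hh => hn (by exact_mod_cast hh.2), if_neg hn]
  · intro h p n
    rw [if_pos (by omega), hp, gqeN]
    by_cases hpn : (p : ℤ) ≤ n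
    · lift n to ℕ using by omega
      rw [Finset.sum_congr rfl fun a ha => by
        rw [gqeT, if_pos ⟨by simpa [Nat.lt_succ_iff] using ha, hpn⟩, Int.toNat_natCast],
        h p n (by exact_mod_cast hpn)]
      by_cases hn : p + 1 ≤ n
      · rw [if_pos hn, if_pos ⟨by omega, by exact_mod_cast hn⟩, Int.toNat_natCast]
      · rw [if_neg hn, if_neg fun hh => hn (by exact_mod_cast hh.2)]
    · rw [if_neg fun hh => hpn (by push_cast at hh; omega)]
      exact Finset.sum_eq_zero fun a _ => by rw [gqeT, if_neg fun hh => hpn hh.2]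

lemma natCast_mul_ne_zero [CharZero k] {n l : ℕ} (hl : 1 ≤ l) (hn : l ≤ n) :
    (l : k) * ((n : k) - (l : k) + 1) ≠ 0 := by
  obtain ⟨d, rfl⟩ := Nat.exists_eq_add_of_le hn
  have h1 : (l : k) ≠ 0 := Nat.cast_ne_zero.2 (by omega)
  have h2 : ((d + 1 : ℕ) : k) ≠ 0 := Nat.cast_ne_zero.2 (by omega)
  refine mul_ne_zero h1 ?_
  push_cast at h2 ⊢
  rwa [add_sub_cancel_left]

lemma Colouring.IsHAdmissible.bracket_ne_zero [CharZero k] {ψ : Colouring k}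
    (hψ : ψ.IsHAdmissible) {n l : ℕ} (hl : 1 ≤ l) (hn : l ≤ n) : ψ.bracket n l ≠ 0 := by
  intro h
  refine natCast_mul_ne_zero (k := k) hl hn ?_
  rw [← hψ.1 n l hl hn, h, map_zero]

lemma IsGQESolution.unique [CharZero k] {ψ : Colouring k} (hψ : ψ.IsHAdmissible)
    {M N : NullSequence k} (hM : IsGQESolution ψ ψ (-1) M) (hN : IsGQESolution ψ ψ (-1) N) :
    M = N := by
  rw [isGQESolution_iff] at hM hN
  have h := triangular_eq_zero ψ.bracket (fun n l => hψ.bracket_ne_zero)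
    (fun a z => evalOne (M.1 a - N.1 a) z)
    (fun a B hB z => by rw [eq_zero_of_evalOne_natCast B hB]; exact map_zero _)
    (fun p n hpn => by
      simp only [evalOne_sub, mul_sub, Finset.sum_sub_distrib]
      rw [hM p n hpn, hN p n hpn, sub_self])
  refine Subtype.ext (funext fun a => sub_eq_zero.1 ?_)
  exact eq_zero_of_evalOne_natCast 0 fun n _ => h a n

/-- The solution of the GQE equation at `h = 0`. -/
def classicalSolution (a : ℕ) : Polynomial k :=
  if a = 0 then Polynomial.X else if a = 1 then 1 else 0

/-- Only `a = 0, 1` contribute: the identity is `(n - 2p) + p(n - p + 1) = (p + 1)(n - p)`. -/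
lemma classicalSolution_spec (p : ℕ) (n : k) :
    ∑ a ∈ Finset.range (p + 1), (∏ l ∈ Finset.Ioc (p - a) p, (l : k) * (n - l + 1)) *
      (classicalSolution a).eval (n - 2 * p + 2 * a) = (p + 1) * (n - p) := by
  cases p with
  | zero => simp [classicalSolution]
  | succ q =>
    rw [Finset.sum_range_succ', Finset.sum_range_succ', Finset.sum_eq_zero]
    · have : Finset.Ioc q (q + 1) = {q + 1} := by
        ext
        simp
      simp [classicalSolution, this]
      ring
    · intro a _
      simp [classicalSolution]

/-- Modulo `h`, the solution and `classicalSolution` satisfy the same triangular system over `k`. -/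
lemma IsGQESolution.constantCoeff_eq [CharZero k] {ψ : Colouring k} (hψ : ψ.IsHAdmissible)
    {M : NullSequence k} (hM : IsGQESolution ψ ψ (-1) M) (a : ℕ) :
    coeff 0 (M.1 a) = classicalSolution a := by
  rw [isGQESolution_iff] at hM
  have h := triangular_eq_zero (fun n l => (l : k) * ((n : k) - (l : k) + 1))
    (fun n l => natCast_mul_ne_zero)
    (fun a z => (coeff 0 (M.1 a) - classicalSolution a).eval (z : k))
    (fun a B hB z => (congrArg (Polynomial.eval (z : k)) (polynomial_eq_zero_of_eval_natCast B
      fun n hn => by simpa using hB n hn)).trans Polynomial.eval_zero)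
    (fun p n hpn => by
      have h1 := congrArg constantCoeff (hM p n hpn)
      have h2 : constantCoeff (if p + 1 ≤ n then ψ.bracket n (p + 1) else 0) =
          ((p : k) + 1) * (n - p) := by
        split_ifs with h
        · rw [hψ.1 n (p + 1) (by omega) h]
          push_cast
          ring
        · rw [show n = p by omega]
          simp
      rw [h2, map_sum] at h1
      rw [← sub_eq_zero, ← classicalSolution_spec p (n : k), ← Finset.sum_sub_distrib] at h1
      rw [← h1]
      refine Finset.sum_congr rfl fun a _ => ?_
      have h3 : ∀ l ∈ Finset.Ioc (p - a) p, constantCoeff (ψ.bracket n l) =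
          (l : k) * ((n : k) - l + 1) := fun l hl => by
        rw [Finset.mem_Ioc] at hl
        exact hψ.1 n l (by omega) (by omega)
      rw [map_mul, map_prod, ← coeff_zero_eq_constantCoeff_apply (evalOne _ _), coeff_evalOne,
        Finset.prod_congr rfl h3]
      push_cast
      rw [Polynomial.eval_sub, mul_sub])
  refine sub_eq_zero.1 (polynomial_eq_zero_of_eval_natCast 0 fun n _ => ?_)
  simpa using h a n

lemma prod_Ioc_eq_prod_range {A : Type*} [CommMonoid A] (f : ℕ → A) {a p : ℕ} (h : a ≤ p) :
    ∏ l ∈ Finset.Ioc (p - a) p, f l = ∏ j ∈ Finset.range a, f (p - j) := by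
  refine (Finset.prod_nbij' (fun j => p - j) (fun l => p - l) ?_ ?_ ?_ ?_ ?_).symm
  · intro j hj
    simp at hj ⊢
    omega
  · intro j hj
    simp at hj ⊢
    omega
  · intro j hj
    simp at hj ⊢
    omega
  · intro j hj
    simp at hj ⊢
    omega
  · intro j hj
    rfl

/-- The solution is read off from the expansion of `[ψ](u, v + 1)` in the basis `descProd Q`,
evaluated at `(n, p)`. -/
lemma exists_isGQESolution [CharZero k] {ψ : Colouring k} (hψ : ψ.IsHAdmissible) :
    ∃ M : NullSequence k, IsGQESolution ψ ψ (-1) M := by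
  obtain ⟨Q, hQ0, hQ, hdiag, hzero⟩ := hψ.exists_invariant
  obtain ⟨D, hD⟩ := exists_topological_expansion (descProd Q)
    (fun a => (constantCoeff_descProd hQ0 a).1) (fun a => (constantCoeff_descProd hQ0 a).2)
    (PowerSeries.map (shiftInv (-1)) Q)
  -- The coefficient `D_a` is evaluated at `w = n - 2p`, whereas the equation evaluates `M_a` at `n
  -- - 2p + 2a`.
  let M : ℕ → (Polynomial k)⟦X⟧ := fun a =>
    PowerSeries.mk fun m => (D m a).comp (Polynomial.X - Polynomial.C (2 * (a : k)))
  have hM : ∀ m : ℕ, ∃ p₀ : ℕ, ∀ p ≥ p₀, (X : (Polynomial k)⟦X⟧) ^ m ∣ M p := by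
    intro m
    -- Beyond the finite supports of `D 0, …, D (m - 1)`, all coefficients of order less than `m`
    -- vanish.
    refine ⟨((Finset.range m).biUnion fun i => (D i).support).sup id + 1, fun p hp => ?_⟩
    rw [X_pow_dvd_iff]
    intro i hi
    have : D i p = 0 := by
      by_contra hne
      have h1 : p ∈ (Finset.range m).biUnion fun i => (D i).support :=
        Finset.mem_biUnion.2 ⟨i, Finset.mem_range.2 hi, Finsupp.mem_support_iff.2 hne⟩
      have h2 := Finset.le_sup (f := id) h1
      simp only [id] at h2
      omega
    rw [coeff_mk, this, Polynomial.zero_comp]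
  refine ⟨⟨M, hM⟩, (isGQESolution_iff _ _).2 fun p n hpn => ?_⟩
  have hval : ∀ a, a ≤ p → ∏ l ∈ Finset.Ioc (p - a) p, ψ.bracket n l =
      PowerSeries.map (evalInv (n : k) (p : k)) (descProd Q a) := by
    intro a ha
    rw [prod_Ioc_eq_prod_range _ ha, map_evalInv_descProd]
    refine Finset.prod_congr rfl fun j hj => ?_
    rw [Finset.mem_range] at hj
    rw [hQ n (p - j) (by omega) (by omega), Nat.cast_sub (by omega)]
  -- The factor with `j = p` is `[ψ](n, 0) = 0`.
  have hvan : ∀ a, p < a → PowerSeries.map (evalInv (n : k) (p : k)) (descProd Q a) = 0 := by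
    intro a ha
    rw [map_evalInv_descProd]
    refine Finset.prod_eq_zero (Finset.mem_range.2 ha) ?_
    rw [sub_self, hzero]
  have hrhs : (if p + 1 ≤ n then ψ.bracket n (p + 1) else 0) =
      PowerSeries.map (evalInv (n : k) (p : k)) (PowerSeries.map (shiftInv (-1)) Q) := by
    have h1 : PowerSeries.map (evalInv (n : k) (p : k)) (PowerSeries.map (shiftInv (-1)) Q) =
        PowerSeries.map (evalInv (n : k) ((p : k) + 1)) Q := by
      ext m
      rw [coeff_map, coeff_map, coeff_map, evalInv_shiftInv, sub_neg_eq_add]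
    rw [h1]
    split_ifs with h
    · rw [hQ n (p + 1) (by omega) h]
      push_cast
      rfl
    · rw [show n = p by omega, hdiag]
  rw [hrhs]
  ext m
  rw [coeff_map, ← hD m, map_sum, map_sum,
    Finset.sum_congr rfl fun a ha => by
      rw [hval a (by simpa [Nat.lt_succ_iff] using ha), mul_comm, coeff_mul], Finset.sum_comm]
  refine Finset.sum_congr rfl fun ij _ => ?_
  rw [Finsupp.sum, map_sum]
  simp only [map_mul, evalInv_C, coeff_evalOne, coeff_map]
  have hcomp : ∀ a, (coeff ij.1 (M a)).eval (((n : ℤ) - 2 * p + 2 * a : ℤ) : k) =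
      (D ij.1 a).eval ((n : k) - 2 * p) := by
    intro a
    simp [M]
  simp only [hcomp]
  -- Both sums extend to the union of their index sets: one by the vanishing of the products for `a
  -- > p`, the other by the definition of the support.
  refine (Finset.sum_subset (Finset.subset_union_left (s₂ := (D ij.1).support)) ?_).trans
    (Finset.sum_subset (Finset.subset_union_right (s₁ := Finset.range (p + 1))) ?_).symm
  · intro a _ ha
    have := congrArg (coeff ij.2) (hvan a (by simpa using ha))
    rw [coeff_map, map_zero] at this
    rw [this, mul_zero]
  · intro a _ ha
    rw [Finsupp.notMem_support_iff.1 ha]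
    simp

end gqeEquation

/-! ### Fixed points of contractions and substitution in power series -/

/-- A map of power series, such that the `n`-th coefficient of the value depends on the coefficients
of order less than `n` only, has a fixed point. -/
lemma exists_fixedPoint {A : Type*} [Semiring A] (Γ : A⟦X⟧ → A⟦X⟧)
    (hΓ : ∀ n T T', (∀ i < n, coeff i T = coeff i T') → coeff n (Γ T) = coeff n (Γ T')) :
    ∃ T, Γ T = T := by
  have h1 : ∀ N T T', ∀ i < N, coeff i (Γ^[N] T) = coeff i (Γ^[N] T') := by
    intro N
    induction N with
    | zero => intro _ _ i hi; omega
    | succ N ih =>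
      intro T T' i hi
      rw [Function.iterate_succ_apply', Function.iterate_succ_apply']
      exact hΓ i _ _ fun j hj => ih T T' j (by omega)
  -- The coefficient of order `i` is stationary from the iterate `i + 1` on, whatever the starting
  -- point.
  have h2 : ∀ N i, i < N → coeff i (Γ^[N] 0) = coeff i (Γ^[i + 1] 0) := by
    intro N i hi
    obtain ⟨d, rfl⟩ := Nat.exists_eq_add_of_le (show i + 1 ≤ N from hi)
    rw [Function.iterate_add_apply]
    exact h1 (i + 1) _ _ i (by omega)
  refine ⟨PowerSeries.mk fun m => coeff m (Γ^[m + 1] 0), ?_⟩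
  ext n
  rw [coeff_mk, Function.iterate_succ_apply']
  exact hΓ n _ _ fun i hi => by rw [coeff_mk, h2 n i hi]

/-- The `h`-adically continuous extension to `F⟦h⟧` of a morphism `F → A⟦h⟧`. -/
def continuousExtension {F A : Type*} [Semiring F] [Semiring A] (ρ : F →+* A⟦X⟧) :
    F⟦X⟧ →+* A⟦X⟧ where
  toFun f := PowerSeries.mk fun n =>
    ∑ ij ∈ Finset.HasAntidiagonal.antidiagonal n, coeff ij.2 (ρ (coeff ij.1 f))
  map_zero' := by
    ext n
    simp
  map_add' f g := by
    ext n
    simp [Finset.sum_add_distrib]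
  map_one' := by
    ext n
    rw [coeff_mk, Finset.sum_eq_single (0, n)]
    · simp
    · rintro ⟨a, b⟩ hab hne
      have ha : a ≠ 0 := by
        rintro rfl
        simp at hab
        exact hne (by rw [hab])
      simp [coeff_one, ha]
    · intro hn
      simp at hn
  map_mul' f g := by
    ext n
    rw [coeff_mk, coeff_mul]
    simp only [coeff_mk, coeff_mul, map_sum, map_mul, Finset.sum_mul_sum]
    simp only [← Finset.sum_product', Finset.sum_sigma']
    -- Both sides are sums over quadruples `((a, b), (c, d))`; the bijection exchanges `b` and `c`.
    refine Finset.sum_nbij'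
      (fun x => ⟨(x.2.1.1 + x.2.2.1, x.2.1.2 + x.2.2.2), ((x.2.1.1, x.2.2.1), (x.2.1.2, x.2.2.2))⟩)
      (fun x => ⟨(x.2.1.1 + x.2.2.1, x.2.1.2 + x.2.2.2), ((x.2.1.1, x.2.2.1), (x.2.1.2, x.2.2.2))⟩)
      ?_ ?_ ?_ ?_ ?_ <;>
      rintro ⟨⟨i, j⟩, ⟨⟨a, b⟩, ⟨c, d⟩⟩⟩ hx <;>
      simp only [Finset.mem_sigma, Finset.mem_product, Finset.HasAntidiagonal.mem_antidiagonal]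
        at hx ⊢ <;>
      obtain ⟨h1, h2, h3⟩ := hx
    · exact ⟨by omega, trivial, trivial⟩
    · exact ⟨by omega, trivial, trivial⟩
    · subst h2 h3
      rfl
    · subst h2 h3
      rfl

lemma coeff_continuousExtension {F A : Type*} [Semiring F] [Semiring A] (ρ : F →+* A⟦X⟧)
    (f : F⟦X⟧) (n : ℕ) : coeff n (continuousExtension ρ f) =
      ∑ ij ∈ Finset.HasAntidiagonal.antidiagonal n, coeff ij.2 (ρ (coeff ij.1 f)) := by
  simp [continuousExtension]

lemma continuousExtension_C {F A : Type*} [Semiring F] [Semiring A] (ρ : F →+* A⟦X⟧) (x : F) :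
    continuousExtension ρ (PowerSeries.C x) = ρ x := by
  ext n
  rw [coeff_continuousExtension, Finset.sum_eq_single (0, n)]
  · simp
  · rintro ⟨a, b⟩ hab hne
    have ha : a ≠ 0 := by
      rintro rfl
      simp at hab
      exact hne (by rw [hab])
    simp [coeff_C, ha]
  · intro hn
    simp at hn

lemma continuousExtension_X {F A : Type*} [Semiring F] [Semiring A] (ρ : F →+* A⟦X⟧) :
    continuousExtension ρ PowerSeries.X = PowerSeries.X := by
  ext n
  rw [coeff_continuousExtension]
  cases n with
  | zero => simp
  | succ n =>
    rw [Finset.sum_eq_single (1, n)]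
    · simp [coeff_X, coeff_one]
    · rintro ⟨a, b⟩ hab hne
      have ha : a ≠ 1 := by
        rintro rfl
        simp at hab
        exact hne (by rw [show b = n by omega])
      simp [coeff_X, ha]
    · intro hn
      simp at hn
      omega

/-! ### Weights -/

section weight

variable {A : Type*} [Ring A]

/-- The element `t` is an eigenvector for the commutator with `H`, with eigenvalue `c`. -/
def HasWeight (H : A) (c : ℤ) (t : A) : Prop := H * t = t * H + c • t

lemma HasWeight.zero (H : A) (c : ℤ) : HasWeight H c 0 := by simp [HasWeight]

lemma HasWeight.one (H : A) : HasWeight H 0 1 := by simp [HasWeight]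

lemma HasWeight.add {H : A} {c : ℤ} {t t' : A} (h : HasWeight H c t) (h' : HasWeight H c t') :
    HasWeight H c (t + t') := by
  unfold HasWeight at *
  rw [mul_add, h, h', add_mul, smul_add]
  abel

lemma HasWeight.sum {ι : Type*} {s : Finset ι} {H : A} {c : ℤ} {f : ι → A}
    (h : ∀ i ∈ s, HasWeight H c (f i)) : HasWeight H c (∑ i ∈ s, f i) :=
  Finset.sum_induction f _ (fun _ _ => HasWeight.add) (HasWeight.zero H c) h

lemma HasWeight.finsum {ι : Type*} {H : A} {c : ℤ} {f : ι → A}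
    (h : ∀ i, HasWeight H c (f i)) : HasWeight H c (∑ᶠ i, f i) :=
  finsum_induction _ (HasWeight.zero H c) (fun _ _ => HasWeight.add) h

lemma HasWeight.mul {H : A} {c c' : ℤ} {t t' : A} (h : HasWeight H c t) (h' : HasWeight H c' t') :
    HasWeight H (c + c') (t * t') := by
  unfold HasWeight at *
  rw [← mul_assoc, h, add_mul, mul_assoc, h', mul_add, add_smul, smul_mul_assoc, mul_smul_comm,
    mul_assoc]
  abel

lemma HasWeight.pow {H : A} {c : ℤ} {t : A} (h : HasWeight H c t) (a : ℕ) :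
    HasWeight H (a * c) (t ^ a) := by
  induction a with
  | zero => simpa using HasWeight.one H
  | succ a ih =>
    rw [pow_succ, Nat.cast_succ, add_mul, one_mul]
    exact ih.mul h

lemma HasWeight.coeff_pow {H : A} {c : ℤ} {T : A⟦X⟧} {n : ℕ}
    (h : ∀ i ≤ n, HasWeight H c (coeff i T)) (a : ℕ) :
    ∀ i ≤ n, HasWeight H (a * c) (coeff i (T ^ a)) := by
  induction a with
  | zero =>
    intro i _
    rw [pow_zero, PowerSeries.coeff_one]
    split_ifs
    · simpa using HasWeight.one H
    · exact HasWeight.zero _ _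
  | succ a ih =>
    intro i hi
    rw [pow_succ, Nat.cast_succ, add_mul, one_mul, PowerSeries.coeff_mul]
    refine HasWeight.sum fun pq hpq => ?_
    rw [Finset.HasAntidiagonal.mem_antidiagonal] at hpq
    exact (ih _ (by omega)).mul (h _ (by omega))

lemma HasWeight.aeval {k : Type*} [Field k] [Algebra k A] {H H' : A} (h : Commute H H')
    (p : Polynomial k) : HasWeight H 0 (Polynomial.aeval H' p) := by
  have : Commute H (Polynomial.aeval H' p) := by
    induction p using Polynomial.induction_on' with
    | add p q hp hq => rw [map_add]; exact hp.add_right hq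
    | monomial n a =>
      rw [Polynomial.aeval_monomial]
      exact (show Commute H _ from (Algebra.commutes a H).symm).mul_right (h.pow_right n)
  rw [HasWeight, zero_smul, add_zero]
  exact this

lemma coeff_pow_congr {T T' : A⟦X⟧} {n : ℕ} (h : ∀ i ≤ n, coeff i T = coeff i T') (a : ℕ) :
    ∀ i ≤ n, coeff i (T ^ a) = coeff i (T' ^ a) := by
  induction a with
  | zero => simp
  | succ a ih =>
    intro i hi
    rw [pow_succ, pow_succ, PowerSeries.coeff_mul, PowerSeries.coeff_mul]
    refine Finset.sum_congr rfl fun pq hpq => ?_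
    rw [Finset.HasAntidiagonal.mem_antidiagonal] at hpq
    rw [ih _ (by omega), h _ (by omega)]

end weight

/-! ### The series `∑ₐ Lᵃ Sₐ(H) Tᵃ` -/

section series

variable {k : Type*} [Field k] {A : Type*} [Ring A] [Algebra k A]

/-- The contribution `∑ₐ Lᵃ (Sₐ)ₘ(H) (Tᵃ)ⱼ` to the coefficient at `hᵐ⁺ʲ` of `∑ₐ Lᵃ Sₐ(H) Tᵃ`. -/
def gqeTerm (S : NullSequence k) (L H : A) (T : A⟦X⟧) (m j : ℕ) : A :=
  ∑ᶠ a : ℕ, L ^ a * Polynomial.aeval H (coeff m (S.1 a)) * coeff j (T ^ a)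

/-- The coefficient at `hⁿ` of `∑ₐ Lᵃ Sₐ(H) Tᵃ - L T`, if `S` specialises to `(u, 1, 0, …)`. -/
def gqeCorrection (S : NullSequence k) (L H : A) (T : A⟦X⟧) : ℕ → A
  | 0 => H
  | n + 1 => ∑ mj ∈ Finset.HasAntidiagonal.antidiagonal n, gqeTerm S L H T (mj.1 + 1) mj.2

lemma NullSequence.finite_support (S : NullSequence k) (m : ℕ) :
    {a | coeff m (S.1 a) ≠ 0}.Finite := by
  obtain ⟨p₀, hp₀⟩ := S.2 (m + 1)
  refine (Set.finite_lt_nat p₀).subset fun a ha => ?_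
  by_contra hlt
  exact ha (X_pow_dvd_iff.1 (hp₀ a (not_lt.1 hlt)) m (by omega))

lemma finsum_classicalSolution (L H : A) (t : ℕ → A) :
    ∑ᶠ a : ℕ, L ^ a * Polynomial.aeval H (classicalSolution a : Polynomial k) * t a =
      H * t 0 + L * t 1 := by
  rw [finsum_eq_sum_of_support_subset (s := Finset.range 2)]
  · simp [Finset.sum_range_succ, classicalSolution]
  · intro a ha
    by_contra hlt
    simp at hlt
    refine ha ?_
    simp [classicalSolution, show a ≠ 0 by omega, show a ≠ 1 by omega]

/-- The terms with `m = 0` come from `(u, 1, 0, …)`: they give `L T`, and `H` at order zero. The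
remaining terms, with `m ≥ 1`, form the correction. -/
lemma sum_gqeTerm {S : NullSequence k} (hS : ∀ a, coeff 0 (S.1 a) = classicalSolution a)
    (L H : A) (T : A⟦X⟧) (n : ℕ) :
    ∑ mj ∈ Finset.HasAntidiagonal.antidiagonal n, gqeTerm S L H T mj.1 mj.2 =
      L * coeff n T + gqeCorrection S L H T n := by
  have h0 : ∀ j, gqeTerm S L H T 0 j = H * coeff j (1 : A⟦X⟧) + L * coeff j T := by
    intro j
    simp only [gqeTerm, hS]
    rw [finsum_classicalSolution L H fun a => coeff j (T ^ a), pow_zero, pow_one]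
  cases n with
  | zero =>
    simp [h0, gqeCorrection, add_comm]
  | succ n =>
    rw [Finset.Nat.sum_antidiagonal_succ, h0, gqeCorrection]
    simp [coeff_one]

/-- Each power of `T` comes with a coefficient of `S` of order at least one, so only lower
coefficients of `T` enter. This is the contraction property used in `exists_posOp`. -/
lemma gqeCorrection_congr (S : NullSequence k) (L H : A) {T T' : A⟦X⟧} {n : ℕ}
    (h : ∀ i < n, coeff i T = coeff i T') :
    gqeCorrection S L H T n = gqeCorrection S L H T' n := by
  cases n with
  | zero => rfl
  | succ n =>
    refine Finset.sum_congr rfl fun mj hmj => finsum_congr fun a => ?_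
    rw [Finset.HasAntidiagonal.mem_antidiagonal] at hmj
    rw [coeff_pow_congr (n := n) (fun i hi => h i (by omega)) a _ (by omega)]

/-- The weight `-a c` of `Lᵃ` cancels the weight `a c` of the coefficients of `Tᵃ`. -/
lemma HasWeight.gqeCorrection (S : NullSequence k) {L H H' : A} {T : A⟦X⟧} {c : ℤ} {n : ℕ}
    (hH : Commute H H') (hL : HasWeight H (-c) L) (h : ∀ i < n, HasWeight H c (coeff i T)) :
    HasWeight H 0 (gqeCorrection S L H' T n) := by
  cases n with
  | zero => simpa [HasWeight, GQE.gqeCorrection] using hH.eq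
  | succ n =>
    refine HasWeight.sum fun mj hmj => HasWeight.finsum fun a => ?_
    rw [Finset.HasAntidiagonal.mem_antidiagonal] at hmj
    have := ((hL.pow a).mul (HasWeight.aeval hH (coeff (mj.1 + 1) (S.1 a)))).mul
      (HasWeight.coeff_pow (n := n) (fun i hi => h i (by omega)) a mj.2 (by omega))
    convert this using 1
    ring

end series

section operators

variable {k I Λ Y : Type*} [Field k] [AddCommGroup Λ] [AddCommGroup Y] (R : RootDatum I Λ Y)

/-! ### The Borel algebra -/

variable (k) in
/-- The relations between the `Xᵢ⁺` and the elements of `Y`. -/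
inductive BorelRel : FreeAlgebra k (I ⊕ Y) → FreeAlgebra k (I ⊕ Y) → Prop
  | add (μ ν : Y) : BorelRel (FreeAlgebra.ι k (Sum.inr (μ + ν)))
      (FreeAlgebra.ι k (Sum.inr μ) + FreeAlgebra.ι k (Sum.inr ν))
  | comm (μ ν : Y) : BorelRel (FreeAlgebra.ι k (Sum.inr μ) * FreeAlgebra.ι k (Sum.inr ν))
      (FreeAlgebra.ι k (Sum.inr ν) * FreeAlgebra.ι k (Sum.inr μ))
  | weight (μ : Y) (i : I) : BorelRel (FreeAlgebra.ι k (Sum.inr μ) * FreeAlgebra.ι k (Sum.inl i))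
      (FreeAlgebra.ι k (Sum.inl i) * FreeAlgebra.ι k (Sum.inr μ) +
        R.pairing μ (R.root i) • FreeAlgebra.ι k (Sum.inl i))

variable (k) in
/-- The algebra generated by the `Xᵢ⁺` and `Y`. -/
def Borel : Type _ := RingQuot (BorelRel k R)

instance : Ring (Borel k R) := inferInstanceAs (Ring (RingQuot (BorelRel k R)))

instance : Algebra k (Borel k R) := inferInstanceAs (Algebra k (RingQuot (BorelRel k R)))

/-- The projection from the free algebra to the Borel algebra. -/
def Borel.mk : FreeAlgebra k (I ⊕ Y) →ₐ[k] Borel k R := RingQuot.mkAlgHom k (BorelRel k R)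

lemma Borel.mk_surjective : Function.Surjective (Borel.mk (k := k) R) :=
  RingQuot.mkAlgHom_surjective k _

/-- The generator `Xᵢ⁺` of the Borel algebra. -/
def Borel.pos (i : I) : Borel k R := Borel.mk R (FreeAlgebra.ι k (Sum.inl i))

/-- The generator `μ ∈ Y` of the Borel algebra. -/
def Borel.cartan (μ : Y) : Borel k R := Borel.mk R (FreeAlgebra.ι k (Sum.inr μ))

lemma Borel.cartan_add (μ ν : Y) :
    Borel.cartan (k := k) R (μ + ν) = Borel.cartan R μ + Borel.cartan R ν := by
  rw [cartan, cartan, cartan, ← map_add]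
  exact RingQuot.mkAlgHom_rel k (BorelRel.add μ ν)

lemma Borel.cartan_comm (μ ν : Y) : Commute (Borel.cartan (k := k) R μ) (Borel.cartan R ν) := by
  rw [Commute, SemiconjBy, cartan, cartan, ← map_mul, ← map_mul]
  exact RingQuot.mkAlgHom_rel k (BorelRel.comm μ ν)

lemma Borel.hasWeight_pos (μ : Y) (i : I) :
    HasWeight (Borel.cartan (k := k) R μ) (R.pairing μ (R.root i)) (Borel.pos R i) := by
  rw [HasWeight, cartan, pos, ← map_mul, ← map_mul, ← map_zsmul, ← map_add]
  exact RingQuot.mkAlgHom_rel k (BorelRel.weight μ i)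

/-! ### Operators on the induced module -/

variable (k) in
/-- The tensor product of the free algebra on the `Xᵢ⁻` and of the Borel algebra; the basis element
`w` is the monomial in the `Xᵢ⁻` given by the list `w`. -/
abbrev Induced : Type _ := List I →₀ Borel k R

variable (k) in
/-- The algebra of linear endomorphisms of the module `Induced`. -/
abbrev InducedEnd : Type _ := Module.End k (Induced k R)

/-- The operator of left multiplication by `Xⱼ⁻`. -/
def prepend (j : I) : InducedEnd k R := Finsupp.lmapDomain (Borel k R) k (List.cons j)

lemma prepend_single (j : I) (w : List I) (b : Borel k R) :
    prepend R j (Finsupp.single w b) = Finsupp.single (j :: w) b := Finsupp.mapDomain_single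

lemma inducedEnd_ext {T T' : InducedEnd k R}
    (h : ∀ w b, T (Finsupp.single w b) = T' (Finsupp.single w b)) : T = T' :=
  Finsupp.lhom_ext h

/-- The opposite of the weight of a monomial in the `Xᵢ⁻`. -/
def listWeight (w : List I) : Λ := (w.map R.root).sum

/-- The operator of left multiplication by `μ ∈ Y`. -/
def cartanOp (μ : Y) : InducedEnd k R :=
  Finsupp.lsum k fun w => Finsupp.lsingle w ∘ₗ LinearMap.mulLeft k
    (Borel.cartan R μ - ((R.pairing μ (listWeight R w) : ℤ) : Borel k R))

lemma cartanOp_single (μ : Y) (w : List I) (b : Borel k R) :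
    cartanOp R μ (Finsupp.single w b) = Finsupp.single w
      ((Borel.cartan R μ - ((R.pairing μ (listWeight R w) : ℤ) : Borel k R)) * b) := by
  simp [cartanOp]

lemma cartanOp_add (μ ν : Y) :
    cartanOp (k := k) R (μ + ν) = cartanOp R μ + cartanOp R ν := by
  refine inducedEnd_ext R fun w b => ?_
  rw [LinearMap.add_apply, cartanOp_single, cartanOp_single, cartanOp_single,
    ← Finsupp.single_add, Borel.cartan_add, map_add, LinearMap.add_apply]
  push_cast
  congr 1
  simp only [sub_mul, add_mul]
  abel

lemma cartanOp_comm (μ ν : Y) : Commute (cartanOp (k := k) R μ) (cartanOp R ν) := by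
  refine inducedEnd_ext R fun w b => ?_
  rw [Module.End.mul_apply, Module.End.mul_apply, cartanOp_single, cartanOp_single,
    cartanOp_single, cartanOp_single, ← mul_assoc, ← mul_assoc]
  congr 2
  exact ((Borel.cartan_comm R μ ν).sub_left (Int.cast_commute _ _)).sub_right
    (((Int.commute_cast _ _)).sub_left (Int.cast_commute _ _))

lemma hasWeight_prepend (μ : Y) (j : I) :
    HasWeight (cartanOp (k := k) R μ) (-R.pairing μ (R.root j)) (prepend R j) := by
  refine inducedEnd_ext R fun w b => ?_
  rw [LinearMap.add_apply, LinearMap.smul_apply, Module.End.mul_apply, Module.End.mul_apply,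
    prepend_single, cartanOp_single, cartanOp_single, prepend_single, Finsupp.smul_single,
    ← Finsupp.single_add]
  congr 1
  rw [show listWeight R (j :: w) = R.root j + listWeight R w by simp [listWeight], map_add]
  push_cast
  rw [neg_smul, zsmul_eq_mul]
  noncomm_ring

/-- The values on monomials of the operator `T` such that `T` is `A` on `1 ⊗ b` and such that
`T Xⱼ⁻ = Xⱼ⁻ T + Kⱼ`. -/
def extendAux (A : Borel k R →ₗ[k] Induced k R) (K : I → InducedEnd k R) :
    List I → Borel k R →ₗ[k] Induced k R
  | [] => A
  | j :: w => prepend R j ∘ₗ extendAux A K w + K j ∘ₗ Finsupp.lsingle w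

/-- The operator `T` such that `T` is `A` on `1 ⊗ b` and such that `T Xⱼ⁻ = Xⱼ⁻ T + Kⱼ`. -/
def extendOp (A : Borel k R →ₗ[k] Induced k R) (K : I → InducedEnd k R) : InducedEnd k R :=
  Finsupp.lsum k (extendAux R A K)

lemma extendOp_nil (A : Borel k R →ₗ[k] Induced k R) (K : I → InducedEnd k R) (b : Borel k R) :
    extendOp R A K (Finsupp.single [] b) = A b := by
  simp [extendOp, extendAux]

lemma extendOp_mul_prepend (A : Borel k R →ₗ[k] Induced k R) (K : I → InducedEnd k R) (j : I) :
    extendOp R A K * prepend R j = prepend R j * extendOp R A K + K j := by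
  refine inducedEnd_ext R fun w b => ?_
  rw [LinearMap.add_apply, Module.End.mul_apply, Module.End.mul_apply, prepend_single]
  simp [extendOp, extendAux]

/-- Induction on the word: moving `T` past `Xⱼ⁻` creates `Kⱼ`, whose weight is that of `T Xⱼ⁻`. -/
lemma hasWeight_extendOp {A : Borel k R →ₗ[k] Induced k R} {K : I → InducedEnd k R} {μ : Y} {c : ℤ}
    (hA : ∀ b, cartanOp R μ (A b) = A (Borel.cartan R μ * b) + c • A b)
    (hK : ∀ j, HasWeight (cartanOp R μ) (c - R.pairing μ (R.root j)) (K j)) :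
    HasWeight (cartanOp R μ) c (extendOp R A K) := by
  refine inducedEnd_ext R fun w b => ?_
  induction w generalizing b with
  | nil =>
    rw [LinearMap.add_apply, LinearMap.smul_apply, Module.End.mul_apply, Module.End.mul_apply,
      cartanOp_single, extendOp_nil, extendOp_nil, hA]
    simp [listWeight]
  | cons j w ih =>
    set T := extendOp R A K
    have h1 : T * prepend R j = prepend R j * T + K j := extendOp_mul_prepend R A K j
    have h2 : HasWeight (cartanOp (k := k) R μ) (-R.pairing μ (R.root j)) (prepend R j) :=
      hasWeight_prepend R μ j
    set H := cartanOp (k := k) R μ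
    set L := prepend (k := k) R j
    have h3 := hK j
    rw [← prepend_single, ← Module.End.mul_apply, ← Module.End.mul_apply]
    set x : Induced k R := Finsupp.single w b
    have h4 : (H * T) x = (T * H + c • T) x := ih b
    -- Both sides are rewritten with `L` leftmost. The terms `L (H T)` and `L (T H + c T)` then
    -- agree on `x` by induction, and the terms in `Kⱼ` by its weight.
    have e1 : H * T * L = L * (H * T) + (-R.pairing μ (R.root j)) • (L * T) + H * K j := by
      rw [mul_assoc, h1, mul_add, ← mul_assoc, h2, add_mul, mul_assoc, smul_mul_assoc]
    have e2 : (T * H + c • T) * L = L * (T * H + c • T) + K j * H + c • K j +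
        (-R.pairing μ (R.root j)) • (L * T + K j) := by
      rw [add_mul, mul_assoc, h2, mul_add, ← mul_assoc, h1, mul_smul_comm, h1, smul_mul_assoc, h1]
      simp only [mul_add, add_mul, smul_add, mul_smul_comm, mul_assoc]
      abel
    have e3 : (L * (H * T)) x = (L * (T * H + c • T)) x := by
      rw [Module.End.mul_apply, h4, Module.End.mul_apply]
    have e4 : H * K j = K j * H + (c - R.pairing μ (R.root j)) • K j := h3
    change (H * T * L) x = ((T * H + c • T) * L) x
    rw [e1, e2, e4]
    simp only [LinearMap.add_apply, e3, LinearMap.smul_apply, smul_add, sub_smul, neg_smul]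
    abel

/-- The action of `Xᵢ⁺` on `1 ⊗ b`. -/
def vacuumPos (i : I) : Borel k R →ₗ[k] Induced k R :=
  Finsupp.lsingle [] ∘ₗ LinearMap.mulLeft k (Borel.pos R i)

-- The values on `1 ⊗ b` and the commutators with all `Xⱼ⁻` determine an operator. Here the
-- commutator with `Xᵢ⁻` is the correction, which depends on lower coefficients only, so `T` is a
-- fixed point; its weight follows by strong induction on the order.
open Classical in
lemma exists_posOp {S : NullSequence k} (hS : ∀ a, coeff 0 (S.1 a) = classicalSolution a) (i : I) :
    ∃ T : (InducedEnd k R)⟦X⟧,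
      (∀ n b, coeff n T (Finsupp.single [] b) =
        if n = 0 then Finsupp.single [] (Borel.pos R i * b) else 0) ∧
      (∀ j n, j ≠ i → coeff n T * prepend R j = prepend R j * coeff n T) ∧
      (∀ n, coeff n T * prepend R i = ∑ mj ∈ Finset.HasAntidiagonal.antidiagonal n,
        gqeTerm S (prepend R i) (cartanOp R (R.coroot i)) T mj.1 mj.2) ∧
      ∀ μ n, HasWeight (cartanOp R μ) (R.pairing μ (R.root i)) (coeff n T) := by
  let L : InducedEnd k R := prepend R i
  let H : InducedEnd k R := cartanOp R (R.coroot i)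
  let A : ℕ → Borel k R →ₗ[k] Induced k R := fun n => if n = 0 then vacuumPos R i else 0
  let K : (InducedEnd k R)⟦X⟧ → ℕ → I → InducedEnd k R := fun T n j =>
    if j = i then gqeCorrection S L H T n else 0
  obtain ⟨T, hT⟩ := exists_fixedPoint
    (fun T : (InducedEnd k R)⟦X⟧ => PowerSeries.mk fun n => extendOp R (A n) (K T n)) (by
      intro n T T' h
      simp only [coeff_mk, K]
      rw [gqeCorrection_congr S L H h])
  have hn : ∀ n, coeff n T = extendOp R (A n) (K T n) := by
    intro n
    conv_lhs => rw [← hT, coeff_mk]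
  refine ⟨T, ?_, ?_, ?_, ?_⟩
  · intro n b
    rw [hn, extendOp_nil]
    simp only [A]
    split_ifs <;> simp [vacuumPos]
  · intro j n hj
    rw [hn, extendOp_mul_prepend]
    simp [K, hj]
  · intro n
    rw [sum_gqeTerm hS]
    conv_lhs => rw [hn, extendOp_mul_prepend, ← hn]
    simp [K, L, H]
  · intro μ n
    induction n using Nat.strong_induction_on with
    | _ n ih =>
      rw [hn]
      refine hasWeight_extendOp R (fun b => ?_) fun j => ?_
      · simp only [A]
        split_ifs
        · have := Borel.hasWeight_pos (k := k) R μ i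
          simp only [vacuumPos, LinearMap.comp_apply, LinearMap.mulLeft_apply,
            Finsupp.lsingle_apply, cartanOp_single, listWeight, List.map_nil, List.sum_nil,
            map_zero, Int.cast_zero, sub_zero, Finsupp.smul_single]
          rw [← Finsupp.single_add, ← mul_assoc, this, add_mul, mul_assoc, smul_mul_assoc]
        · simp
      · simp only [K]
        split_ifs with hj
        · subst hj
          rw [sub_self]
          exact HasWeight.gqeCorrection S (cartanOp_comm R _ _) (hasWeight_prepend R μ j) ih
        · exact HasWeight.zero _ _

end operators

/-! ### Weights and relations for power series and under ring morphisms -/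

lemma HasWeight.of_coeff {A : Type*} [Ring A] {H : A} {c : ℤ} {T : A⟦X⟧}
    (h : ∀ n, HasWeight H c (coeff n T)) : HasWeight (C H) c T := by
  ext1 n
  rw [coeff_C_mul, map_add, coeff_mul_C, map_zsmul]
  exact h n

lemma HasWeight.coeff_C {A : Type*} [Ring A] {H : A} {c : ℤ} {t : A} (h : HasWeight H c t) (n : ℕ) :
    HasWeight H c (coeff n (C t : A⟦X⟧)) := by
  rw [PowerSeries.coeff_C]
  split_ifs
  exacts [h, HasWeight.zero H c]

lemma HasWeight.map {A B : Type*} [Ring A] [Ring B] (φ : A →+* B) {H : A} {c : ℤ} {t : A}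
    (h : HasWeight H c t) : HasWeight (φ H) c (φ t) := by
  rw [HasWeight, ← map_mul, h, map_add, map_mul, map_zsmul]

lemma NonDefRel.map_ringHom {I Λ Y : Type*} [AddCommGroup Λ] [AddCommGroup Y]
    {R : RootDatum I Λ Y} {A B : Type*} [Ring A] [Ring B] (φ : A →+* B) {f : Gen I Y → A} {x : A}
    (hx : NonDefRel R f x) : NonDefRel R (φ ∘ f) (φ x) :=
  hx.map φ.toAddMonoidHom fun x y => by simp [Ring.lie_def]

lemma NonDefRel.eq_zero {I Λ Y : Type*} [AddCommGroup Λ] [AddCommGroup Y] {R : RootDatum I Λ Y}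
    {A : Type*} [Ring A] {f : Gen I Y → A}
    (hadd : ∀ μ ν, f (.cartan (μ + ν)) = f (.cartan μ) + f (.cartan ν))
    (hcomm : ∀ μ ν, Commute (f (.cartan μ)) (f (.cartan ν)))
    (hpos : ∀ μ i, HasWeight (f (.cartan μ)) (R.pairing μ (R.root i)) (f (.pos i)))
    (hneg : ∀ μ i, HasWeight (f (.cartan μ)) (-R.pairing μ (R.root i)) (f (.neg i)))
    (hpn : ∀ i j, i ≠ j → Commute (f (.pos i)) (f (.neg j))) {x : A} (hx : NonDefRel R f x) :
    x = 0 := by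
  cases hx with
  | add μ ν => rw [hadd, sub_self]
  | comm μ ν => rw [Ring.lie_def, (hcomm μ ν).eq, sub_self]
  | weight_pos μ i => rw [Ring.lie_def, hpos μ i, add_sub_cancel_left, sub_self]
  | weight_neg μ i => rw [Ring.lie_def, hneg μ i, add_sub_cancel_left, sub_self]
  | pos_neg i j hij => rw [Ring.lie_def, (hpn i j hij).eq, sub_self]

lemma coeff_algHom_gqe {k F A : Type*} [Field k] [Ring F] [Algebra k F] [Ring A] [Algebra k A]
    (ρ : F →ₐ[k] A⟦X⟧) {x y t : F} {L H : A} (hx : ρ x = C L) (hy : ρ y = C H) (p : Polynomial k)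
    (a j : ℕ) : coeff j (ρ (x ^ a * Polynomial.aeval y p * t ^ a)) =
      L ^ a * Polynomial.aeval H p * coeff j (ρ t ^ a) := by
  let φ : A →ₐ[k] A⟦X⟧ :=
    { (C : A →+* A⟦X⟧) with commutes' := fun c => (PowerSeries.algebraMap_apply (A := A)).symm }
  rw [map_mul ρ, map_mul ρ, map_pow ρ, map_pow ρ, ← Polynomial.aeval_algHom_apply, hx, hy]
  have : Polynomial.aeval (C H : A⟦X⟧) p = C (Polynomial.aeval H p) :=
    Polynomial.aeval_algHom_apply φ H p
  rw [this, ← map_pow, ← map_mul, coeff_C_mul]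

/-! ### Representations of the generators by power series -/

section genRep

variable {k I Y A : Type*} [Field k] [Ring A] [Algebra k A]

/-- The morphism from the free algebra on the generators to `A⟦h⟧` with constant values `L` and `H`
on the `Xᵢ⁻` and on `Y`, and with values `T` on the `Xᵢ⁺`. -/
def genRep (L : I → A) (H : Y → A) (T : I → A⟦X⟧) : FreeAlgebra k (Gen I Y) →ₐ[k] A⟦X⟧ :=
  FreeAlgebra.lift k fun
    | .neg i => C (L i)
    | .pos i => T i
    | .cartan μ => C (H μ)

variable (L : I → A) (H : Y → A) (T : I → A⟦X⟧)

lemma genRep_neg (i : I) : genRep (k := k) L H T (FreeAlgebra.ι k (.neg i)) = C (L i) := by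
  simp [genRep]

lemma genRep_pos (i : I) : genRep (k := k) L H T (FreeAlgebra.ι k (.pos i)) = T i := by
  simp [genRep]

lemma genRep_cartan (μ : Y) : genRep (k := k) L H T (FreeAlgebra.ι k (.cartan μ)) = C (H μ) := by
  simp [genRep]

lemma continuousExtension_genRep_gen (g : Gen I Y) :
    continuousExtension (genRep (k := k) L H T).toRingHom (gen k g) =
      genRep L H T (FreeAlgebra.ι k g) :=
  continuousExtension_C _ _

variable {L H T} {Λ : Type*} [AddCommGroup Λ] [AddCommGroup Y] {R : RootDatum I Λ Y}

lemma genRep_nonDefRel (hadd : ∀ μ ν, H (μ + ν) = H μ + H ν) (hcomm : ∀ μ ν, Commute (H μ) (H ν))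
    (hL : ∀ μ i, HasWeight (H μ) (-R.pairing μ (R.root i)) (L i))
    (hT : ∀ μ i n, HasWeight (H μ) (R.pairing μ (R.root i)) (coeff n (T i)))
    (hTL : ∀ i j n, i ≠ j → Commute (coeff n (T i)) (L j))
    {x : FreeFormalAlgebra k (Gen I Y)} (hx : NonDefRel R (gen k) x) :
    continuousExtension (genRep (k := k) L H T).toRingHom x = 0 := by
  have h := hx.map_ringHom (continuousExtension (genRep (k := k) L H T).toRingHom)
  rw [show continuousExtension (genRep (k := k) L H T).toRingHom ∘ gen k =
    fun g => genRep L H T (FreeAlgebra.ι k g) from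
      funext (continuousExtension_genRep_gen L H T)] at h
  refine NonDefRel.eq_zero (fun μ ν => ?_) (fun μ ν => ?_) (fun μ i => ?_) (fun μ i => ?_)
    (fun i j hij => ?_) h
  · rw [genRep_cartan, genRep_cartan, genRep_cartan, hadd, map_add]
  · rw [genRep_cartan, genRep_cartan]
    exact (hcomm μ ν).map C
  · rw [genRep_cartan, genRep_pos]
    exact HasWeight.of_coeff (hT μ i)
  · rw [genRep_cartan, genRep_neg]
    exact (hL μ i).map C
  · rw [genRep_pos, genRep_neg, Commute, SemiconjBy]
    ext1 n
    rw [coeff_C_mul, coeff_mul_C]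
    exact hTL i j n hij

lemma coeff_continuousExtension_gqeSeries (S : NullSequence k) (i : I) (n : ℕ) :
    coeff n (continuousExtension (genRep (k := k) L H T).toRingHom (gqeSeries R S i)) =
      ∑ mj ∈ Finset.HasAntidiagonal.antidiagonal n,
        gqeTerm S (L i) (H (R.coroot i)) (T i) mj.1 mj.2 := by
  rw [coeff_continuousExtension]
  refine Finset.sum_congr rfl fun mj _ => ?_
  rw [gqeSeries, coeff_mk]
  let Ψ : FreeAlgebra k (Gen I Y) →+ A :=
    (coeff (R := A) mj.2).toAddMonoidHom.comp (genRep L H T).toRingHom.toAddMonoidHom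
  -- Exchanging `Ψ` with the sum needs a finite support, which the convergence of `S` to zero
  -- supplies.
  refine (Ψ.map_finsum ?_).trans (finsum_congr fun a => ?_)
  · refine (S.finite_support mj.1).subset fun a ha h0 => ha ?_
    change _ * Polynomial.aeval _ (coeff mj.1 (S.1 a)) * _ = 0
    exact h0 ▸ by rw [map_zero, mul_zero, zero_mul]
  · have := coeff_algHom_gqe (t := FreeAlgebra.ι k (Gen.pos i)) (genRep L H T)
      (genRep_neg L H T i) (genRep_cartan L H T (R.coroot i)) (coeff mj.1 (S.1 a)) a mj.2
    rw [genRep_pos] at this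
    exact this

lemma genRep_relTilde {S : I → NullSequence k}
    (hadd : ∀ μ ν, H (μ + ν) = H μ + H ν) (hcomm : ∀ μ ν, Commute (H μ) (H ν))
    (hL : ∀ μ i, HasWeight (H μ) (-R.pairing μ (R.root i)) (L i))
    (hT : ∀ μ i n, HasWeight (H μ) (R.pairing μ (R.root i)) (coeff n (T i)))
    (hTL : ∀ i j n, i ≠ j → Commute (coeff n (T i)) (L j))
    (hS : ∀ i n, coeff n (T i) * L i = ∑ mj ∈ Finset.HasAntidiagonal.antidiagonal n,
        gqeTerm (S i) (L i) (H (R.coroot i)) (T i) mj.1 mj.2)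
    {x : FreeFormalAlgebra k (Gen I Y)} (hx : x ∈ relTilde R S) :
    continuousExtension (genRep (k := k) L H T).toRingHom x = 0 := by
  rcases hx with hx | ⟨i, rfl⟩
  · exact genRep_nonDefRel hadd hcomm hL hT hTL hx
  · ext1 n
    rw [map_sub, map_mul, continuousExtension_genRep_gen, continuousExtension_genRep_gen,
      genRep_pos, genRep_neg, map_sub, coeff_continuousExtension_gqeSeries, coeff_mul_C, hS,
      sub_self, map_zero]

end genRep

/-! ### Normal forms -/

section normalForm

variable {k I Λ Y : Type*} [Field k] [AddCommGroup Λ] [AddCommGroup Y] (R : RootDatum I Λ Y)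

/-- The inclusion of the free algebra on the `Xᵢ⁺` and `Y`. -/
def borelIncl : FreeAlgebra k (I ⊕ Y) →ₐ[k] FreeAlgebra k (Gen I Y) :=
  FreeAlgebra.lift k (Sum.elim (fun i => FreeAlgebra.ι k (.pos i))
    fun μ => FreeAlgebra.ι k (.cartan μ))

lemma Borel.exists_section : ∃ s : Borel k R →ₗ[k] FreeAlgebra k (I ⊕ Y),
    (Borel.mk R).toLinearMap ∘ₗ s = LinearMap.id :=
  LinearMap.exists_rightInverse_of_surjective _
    (LinearMap.range_eq_top.2 (Borel.mk_surjective R))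

/-- A linear section of the projection to the Borel algebra. -/
def Borel.section : Borel k R →ₗ[k] FreeAlgebra k (I ⊕ Y) := (Borel.exists_section R).choose

lemma Borel.mk_section (b : Borel k R) : Borel.mk R (Borel.section R b) = b :=
  LinearMap.congr_fun (Borel.exists_section R).choose_spec b

/-- The linear map which sends `w ⊗ b` to the product of the monomial `w` in the `Xᵢ⁻` and of a
representative of `b`. -/
def normalForm : Induced k R →ₗ[k] FreeAlgebra k (Gen I Y) :=
  Finsupp.lsum k fun w => LinearMap.mulLeft k (w.map fun i => FreeAlgebra.ι k (Gen.neg i)).prod ∘ₗ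
    (borelIncl (k := k)).toLinearMap ∘ₗ Borel.section R

lemma normalForm_single (w : List I) (b : Borel k R) : normalForm R (Finsupp.single w b) =
    (w.map fun i => FreeAlgebra.ι k (Gen.neg i)).prod * borelIncl (Borel.section R b) := by
  simp [normalForm]

/-- The series of operators `T` sends the vector `v` to the constant series `v'`. -/
def SendsTo {V : Type*} [AddCommGroup V] [Module k V] (T : (Module.End k V)⟦X⟧) (v v' : V) : Prop :=
  ∀ n, coeff n T v = if n = 0 then v' else 0

section sendsTo

variable {V : Type*} [AddCommGroup V] [Module k V]

lemma SendsTo.add {T T' : (Module.End k V)⟦X⟧} {v u u' : V} (h : SendsTo T v u)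
    (h' : SendsTo T' v u') : SendsTo (T + T') v (u + u') := by
  intro n
  rw [map_add, LinearMap.add_apply, h, h']
  split_ifs <;> simp

lemma SendsTo.sum {ι : Type*} {s : Finset ι} {T : ι → (Module.End k V)⟦X⟧} {v : V} {u : ι → V}
    (h : ∀ i ∈ s, SendsTo (T i) v (u i)) : SendsTo (∑ i ∈ s, T i) v (∑ i ∈ s, u i) := by
  intro n
  rw [map_sum, LinearMap.sum_apply, Finset.sum_congr rfl fun i hi => h i hi n]
  split_ifs <;> simp

lemma SendsTo.mul {T T' : (Module.End k V)⟦X⟧} {v v' v'' : V} (h : SendsTo T v' v'')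
    (h' : SendsTo T' v v') : SendsTo (T * T') v v'' := by
  intro n
  -- The image of `v` under `T'` has only a constant term, so only the pair `(n, 0)` contributes.
  rw [coeff_mul, LinearMap.sum_apply, Finset.sum_eq_single (n, 0)]
  · rw [Module.End.mul_apply, h', if_pos rfl, h]
  · rintro ⟨a, b⟩ hab hne
    have hb : b ≠ 0 := by
      rintro rfl
      simp at hab
      exact hne (by rw [hab])
    rw [Module.End.mul_apply, h', if_neg hb, map_zero]
  · intro hn
    simp at hn

lemma sendsTo_C (t : Module.End k V) (v : V) : SendsTo (C t) v (t v) := by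
  intro n
  rw [coeff_C]
  split_ifs <;> simp

end sendsTo

variable {R}

/-- On `1 ⊗ b` the Borel generators act by left multiplication without terms of positive order in
`h`: the empty word has weight zero and needs no commutation. -/
lemma sendsTo_borelIncl {T : I → (InducedEnd k R)⟦X⟧}
    (hT : ∀ i b, SendsTo (T i) (Finsupp.single [] b) (Finsupp.single [] (Borel.pos R i * b)))
    (x : FreeAlgebra k (I ⊕ Y)) (b : Borel k R) :
    SendsTo (genRep (prepend R) (cartanOp R) T (borelIncl x)) (Finsupp.single [] b)
      (Finsupp.single [] (Borel.mk R x * b)) := by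
  induction x using FreeAlgebra.induction generalizing b with
  | grade0 c =>
    have := sendsTo_C (algebraMap k (InducedEnd k R) c) (Finsupp.single [] b)
    rw [AlgHom.commutes, AlgHom.commutes, AlgHom.commutes]
    rwa [Module.algebraMap_end_apply, Finsupp.smul_single, Algebra.smul_def,
      ← PowerSeries.algebraMap_apply] at this
  | grade1 g =>
    cases g with
    | inl i =>
      rw [borelIncl, FreeAlgebra.lift_ι_apply, Sum.elim_inl, genRep_pos]
      exact hT i b
    | inr μ =>
      rw [borelIncl, FreeAlgebra.lift_ι_apply, Sum.elim_inr, genRep_cartan]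
      have := sendsTo_C (cartanOp (k := k) R μ) (Finsupp.single [] b)
      rwa [cartanOp_single, listWeight, List.map_nil, List.sum_nil, map_zero, Int.cast_zero,
        sub_zero] at this
  | mul x y hx hy =>
    rw [map_mul, map_mul, map_mul, mul_assoc]
    exact (hx _).mul (hy b)
  | add x y hx hy =>
    rw [map_add, map_add, map_add, add_mul, Finsupp.single_add]
    exact (hx b).add (hy b)

/-- The Borel factor acts first, on `1 ⊗ 1`, and then the word is prepended letter by letter, so no
correction in `h` arises. This gives the independence of normal forms. -/
lemma sendsTo_normalForm {T : I → (InducedEnd k R)⟦X⟧}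
    (hT : ∀ i b, SendsTo (T i) (Finsupp.single [] b) (Finsupp.single [] (Borel.pos R i * b)))
    (v : Induced k R) : SendsTo (genRep (prepend R) (cartanOp R) T (normalForm R v)) (Finsupp.single [] 1) v := by
  induction v using Finsupp.induction_linear with
  | zero =>
    intro n
    simp
  | add v v' h h' =>
    rw [map_add, map_add]
    exact h.add h'
  | single w b =>
    rw [normalForm_single, map_mul]
    have h1 := sendsTo_borelIncl hT (Borel.section R b) 1
    rw [Borel.mk_section, mul_one] at h1
    refine SendsTo.mul ?_ h1
    clear h1
    induction w with
    | nil =>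
      rw [List.map_nil, List.prod_nil, map_one]
      have := sendsTo_C (1 : InducedEnd k R) (Finsupp.single [] b)
      simpa using this
    | cons j w ih =>
      rw [List.map_cons, List.prod_cons, map_mul, genRep_neg]
      have := sendsTo_C (prepend R j) (Finsupp.single w b)
      rw [prepend_single] at this
      exact this.mul ih

/-- The algebra `Ũ_h` acts on the formal module of `Induced`. -/
lemma exists_inducedRep (R : RootDatum I Λ Y) {S : I → NullSequence k}
    (hS : ∀ i a, coeff 0 ((S i).1 a) = classicalSolution a) :
    ∃ T : I → (InducedEnd k R)⟦X⟧,
      (∀ i b, SendsTo (T i) (Finsupp.single [] b) (Finsupp.single [] (Borel.pos R i * b))) ∧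
      ∀ x ∈ relTilde R S, continuousExtension (genRep (prepend R) (cartanOp R) T).toRingHom x = 0 := by
  choose T hT0 hT1 hT2 hT3 using fun i => exists_posOp R (hS i) i
  exact ⟨T, fun i b n => hT0 i n b, fun x hx => genRep_relTilde (cartanOp_add R) (cartanOp_comm R)
    (hasWeight_prepend R) (fun μ i n => hT3 i μ n) (fun i j n hij => hT1 i j n hij.symm) hT2 hx⟩

end normalForm

/-! ### The specialisation of a topologically presented algebra -/

section specialisation

variable {k G : Type*} [Field k]

lemma X_pow_smul_formal (m : ℕ) (f : FreeFormalAlgebra k G) :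
    (X : k⟦X⟧) ^ m • f = X ^ m * f := by
  rw [Algebra.smul_def]
  change PowerSeries.map _ _ * f = _
  rw [map_pow, PowerSeries.map_X]

lemma mem_hClosure {A : Type*} [Ring A] [Algebra k⟦X⟧ A] {J : TwoSidedIdeal A} {x : A} :
    x ∈ hClosure k J ↔ ∀ m : ℕ, ∃ y ∈ J, ∃ z : A, x = y + (X : k⟦X⟧) ^ m • z := by
  unfold hClosure
  rw [TwoSidedIdeal.mem_mk']
  rfl

lemma mem_hIdeal {A : Type*} [Ring A] [Algebra k⟦X⟧ A] {x : A} :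
    x ∈ hIdeal k A ↔ ∃ z : A, x = (X : k⟦X⟧) • z := by
  unfold hIdeal
  rw [TwoSidedIdeal.mem_mk']
  rfl

lemma eq_zero_of_mem_span {A B : Type*} [Ring A] [Ring B] (φ : A →+* B) {s : Set A}
    (h : ∀ x ∈ s, φ x = 0) {x : A} (hx : x ∈ TwoSidedIdeal.span s) : φ x = 0 :=
  (TwoSidedIdeal.mem_ker φ).1 <|
    (TwoSidedIdeal.span_le (I := TwoSidedIdeal.ker φ)).2
      (fun y hy => (TwoSidedIdeal.mem_ker φ).2 (h y hy)) hx

variable {rels : Set (FreeFormalAlgebra k G)}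

lemma TopPresented.mk_surjective : Function.Surjective (TopPresented.mk rels) :=
  RingCon.mk'_surjective _

lemma TopPresented.mk_eq_zero_iff {f : FreeFormalAlgebra k G} :
    TopPresented.mk rels f = 0 ↔ f ∈ hClosure k (TwoSidedIdeal.span rels) :=
  (RingCon.eq _).trans (TwoSidedIdeal.mem_iff _ _).symm

lemma specialisationMap_surjective (A : Type*) [Ring A] [Algebra k⟦X⟧ A] [Algebra k A] :
    Function.Surjective (specialisationMap k A) :=
  RingCon.mk'_surjective _

lemma specialisationMap_eq_zero_iff {A : Type*} [Ring A] [Algebra k⟦X⟧ A] [Algebra k A] {x : A} :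
    specialisationMap k A x = 0 ↔ ∃ z : A, x = (X : k⟦X⟧) • z :=
  ((RingCon.eq _).trans (TwoSidedIdeal.mem_iff _ _).symm).trans mem_hIdeal

variable (rels) in
/-- The projection from the free algebra to the specialisation of a topologically presented
algebra. -/
def freeToSpecialisation : FreeAlgebra k G →ₐ[k] Specialisation k (TopPresented rels) :=
  FreeAlgebra.lift k fun g => specialisationMap k _ (TopPresented.of rels g)

lemma specialisationMap_mk_C (x : FreeAlgebra k G) :
    specialisationMap k _ (TopPresented.mk rels (C x)) = freeToSpecialisation rels x := by
  let φ : FreeAlgebra k G →ₐ[k] FreeFormalAlgebra k G :=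
    { (C : FreeAlgebra k G →+* FreeFormalAlgebra k G) with
      commutes' := fun c => (PowerSeries.algebraMap_apply (A := FreeAlgebra k G)).symm }
  have : ((specialisationMap k (TopPresented rels)).comp
      ((TopPresented.mk rels).restrictScalars k)).comp φ = freeToSpecialisation rels := by
    refine FreeAlgebra.hom_ext (funext fun g => ?_)
    rw [Function.comp_apply, Function.comp_apply, freeToSpecialisation, FreeAlgebra.lift_ι_apply]
    rfl
  exact DFunLike.congr_fun this x

/-- A series minus its constant term is divisible by `h`. -/
lemma specialisationMap_mk (f : FreeFormalAlgebra k G) :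
    specialisationMap k _ (TopPresented.mk rels f) =
      freeToSpecialisation rels (constantCoeff f) := by
  rw [← specialisationMap_mk_C, ← sub_eq_zero, ← map_sub, ← map_sub, specialisationMap_eq_zero_iff]
  obtain ⟨g, hg⟩ : X ∣ f - C (constantCoeff f) := by
    rw [X_dvd_iff]
    simp
  refine ⟨TopPresented.mk rels g, ?_⟩
  rw [hg, ← map_smul, ← pow_one (X : k⟦X⟧), X_pow_smul_formal, pow_one]

lemma freeToSpecialisation_surjective : Function.Surjective (freeToSpecialisation rels) := by
  intro y
  obtain ⟨x, rfl⟩ := specialisationMap_surjective _ y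
  obtain ⟨f, rfl⟩ := TopPresented.mk_surjective x
  exact ⟨constantCoeff f, (specialisationMap_mk f).symm⟩

/-- A morphism from the free algebra which annihilates the constant terms of the relations factors
through the specialisation. -/
lemma exists_specialisation_lift {U : Type*} [Ring U] [Algebra k U] (p : FreeAlgebra k G →ₐ[k] U)
    (hp : ∀ r ∈ rels, p (constantCoeff r) = 0) :
    ∃ e : Specialisation k (TopPresented rels) →ₐ[k] U,
      ∀ x, e (freeToSpecialisation rels x) = p x := by
  let φ : FreeFormalAlgebra k G →ₐ[k] U :=
    { p.toRingHom.comp constantCoeff with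
      commutes' := fun c => by
        change p (constantCoeff (algebraMap k (FreeFormalAlgebra k G) c)) = _
        rw [PowerSeries.algebraMap_apply, constantCoeff_C, AlgHom.commutes] }
  have hφ : ∀ z : FreeFormalAlgebra k G, φ ((X : k⟦X⟧) • z) = 0 := by
    intro z
    rw [← pow_one (X : k⟦X⟧), X_pow_smul_formal, pow_one]
    change p (constantCoeff _) = 0
    rw [map_mul, constantCoeff_X, zero_mul, map_zero]
  have h1 : ∀ x ∈ hClosure k (TwoSidedIdeal.span rels), φ x = 0 := by
    intro x hx
    obtain ⟨y, hy, z, rfl⟩ := mem_hClosure.1 hx 1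
    rw [map_add, pow_one, hφ, add_zero]
    exact eq_zero_of_mem_span φ.toRingHom hp hy
  let e₁ : TopPresented rels →ₐ[k] U :=
    RingCon.liftₐ (hClosure k (TwoSidedIdeal.span rels)).ringCon φ (fun x y hxy => by
      rw [TwoSidedIdeal.rel_iff] at hxy
      have := h1 _ hxy
      rw [map_sub, sub_eq_zero] at this
      exact this)
  have he₁ : ∀ f, e₁ (TopPresented.mk rels f) = φ f := fun f => rfl
  let e : Specialisation k (TopPresented rels) →ₐ[k] U :=
    RingCon.liftₐ (hIdeal k (TopPresented rels)).ringCon e₁ (fun x y hxy => by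
      rw [TwoSidedIdeal.rel_iff, mem_hIdeal] at hxy
      obtain ⟨z, hz⟩ := hxy
      obtain ⟨f, rfl⟩ := TopPresented.mk_surjective z
      change e₁ x = e₁ y
      rw [← sub_eq_zero, ← map_sub, hz, ← map_smul, he₁, hφ])
  have he : ∀ x, e (specialisationMap k _ x) = e₁ x := fun x => rfl
  refine ⟨e, fun x => ?_⟩
  rw [← specialisationMap_mk_C, he, he₁]
  change p (constantCoeff (C x)) = p x
  rw [constantCoeff_C]

end specialisation

/-! ### Spanning by normal forms at `h = 0` -/

section spanning

variable {k I Λ Y : Type*} [Field k] [AddCommGroup Λ] [AddCommGroup Y] (R : RootDatum I Λ Y)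

/-- Elements of an algebra satisfying the defining relations of `𝔤̃`. -/
structure IsTildeFamily {U : Type*} [Ring U] (f : Gen I Y → U) : Prop where
  add : ∀ μ ν, f (.cartan (μ + ν)) = f (.cartan μ) + f (.cartan ν)
  comm : ∀ μ ν, Commute (f (.cartan μ)) (f (.cartan ν))
  pos : ∀ μ i, HasWeight (f (.cartan μ)) (R.pairing μ (R.root i)) (f (.pos i))
  neg : ∀ μ i, HasWeight (f (.cartan μ)) (-R.pairing μ (R.root i)) (f (.neg i))
  pos_neg : ∀ i j, i ≠ j → Commute (f (.pos i)) (f (.neg j))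
  pos_neg_self : ∀ i, f (.pos i) * f (.neg i) = f (.neg i) * f (.pos i) + f (.cartan (R.coroot i))

variable {R} {U : Type*} [Ring U] [Algebra k U] {f : Gen I Y → U}

/-- The section of the Borel algebra is only linear, but in `U` the choice of representatives
disappears and the Borel part of a normal form becomes multiplicative. -/
lemma IsTildeFamily.exists_borelLift (hf : IsTildeFamily R f) : ∃ β : Borel k R →ₐ[k] U,
    (∀ i, β (Borel.pos R i) = f (.pos i)) ∧ (∀ μ, β (Borel.cartan R μ) = f (.cartan μ)) ∧
      ∀ b, FreeAlgebra.lift k f (borelIncl (Borel.section R b)) = β b := by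
  let β₀ : FreeAlgebra k (I ⊕ Y) →ₐ[k] U :=
    FreeAlgebra.lift k (Sum.elim (fun i => f (.pos i)) fun μ => f (.cartan μ))
  have hβ₀ : ∀ ⦃x y⦄, BorelRel k R x y → β₀ x = β₀ y := by
    intro x y h
    cases h with
    | add μ ν => simpa [β₀] using hf.add μ ν
    | comm μ ν => simpa [β₀] using (hf.comm μ ν).eq
    | weight μ i => simpa [β₀, HasWeight] using hf.pos μ i
  let β : Borel k R →ₐ[k] U := RingQuot.liftAlgHom k ⟨β₀, hβ₀⟩
  have hβ : ∀ x, β (Borel.mk R x) = β₀ x := fun x => RingQuot.liftAlgHom_mkAlgHom_apply k β₀ hβ₀ x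
  refine ⟨β, fun i => ?_, fun μ => ?_, fun b => ?_⟩
  · rw [Borel.pos, hβ]
    simp [β₀]
  · rw [Borel.cartan, hβ]
    simp [β₀]
  · conv_rhs => rw [← Borel.mk_section R b, hβ]
    have : (FreeAlgebra.lift k f).comp borelIncl = β₀ := by
      refine FreeAlgebra.hom_ext (funext fun g => ?_)
      cases g <;> simp [β₀, borelIncl]
    exact DFunLike.congr_fun this _

lemma IsTildeFamily.hasWeight_prod (hf : IsTildeFamily R f) (μ : Y) (w : List I) :
    HasWeight (f (.cartan μ)) (-R.pairing μ (listWeight R w)) (w.map fun i => f (.neg i)).prod := by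
  induction w with
  | nil => simpa [listWeight] using HasWeight.one (f (.cartan μ))
  | cons j w ih =>
    rw [show listWeight R (j :: w) = R.root j + listWeight R w by simp [listWeight], map_add,
      neg_add, List.map_cons, List.prod_cons]
    exact (hf.neg μ j).mul ih

/-- Every element is congruent to a normal form modulo the relations of `𝔤̃`. -/
lemma IsTildeFamily.exists_normalForm (hf : IsTildeFamily R f) (x : FreeAlgebra k (Gen I Y)) :
    ∃ v : Induced k R, FreeAlgebra.lift k f (normalForm R v) = FreeAlgebra.lift k f x := by
  obtain ⟨β, hβpos, hβcartan, hβ⟩ := hf.exists_borelLift (k := k)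
  let θ : Induced k R →ₗ[k] U := (FreeAlgebra.lift k f).toLinearMap ∘ₗ normalForm R
  have hθ : ∀ w b, θ (Finsupp.single w b) = (w.map fun i => f (.neg i)).prod * β b := by
    intro w b
    change FreeAlgebra.lift k f (normalForm R _) = _
    rw [normalForm_single, map_mul, hβ, map_list_prod, List.map_map]
    congr 3
    funext i
    simp
  -- The span `N` of normal forms contains `1`; stability under left multiplication by the
  -- generators then shows that it contains the image of the free algebra.
  let N : Submodule k U := LinearMap.range θ
  have hmem : ∀ (w : List I) (b : Borel k R), (w.map fun i => f (.neg i)).prod * β b ∈ N := fun w b => ⟨_, hθ w b⟩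
  have hgen : ∀ u : U, (∀ (w : List I) (b : Borel k R), u * ((w.map fun i => f (.neg i)).prod * β b) ∈ N) →
      ∀ n ∈ N, u * n ∈ N := by
    rintro u hu _ ⟨v, rfl⟩
    induction v using Finsupp.induction_linear with
    | zero => simp
    | add v v' h h' =>
      rw [map_add, mul_add]
      exact N.add_mem h h'
    | single w b =>
      rw [hθ]
      exact hu w b
  have hneg : ∀ i, ∀ n ∈ N, f (.neg i) * n ∈ N := by
    intro i
    refine hgen _ fun w b => ?_
    have := hmem (i :: w) b
    rwa [List.map_cons, List.prod_cons, mul_assoc] at this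
  have hcartan : ∀ μ, ∀ n ∈ N, f (.cartan μ) * n ∈ N := by
    intro μ
    refine hgen _ fun w b => ?_
    rw [← mul_assoc, hf.hasWeight_prod μ w, add_mul, mul_assoc, ← hβcartan, ← map_mul,
      smul_mul_assoc]
    exact N.add_mem (hmem w _) (N.toAddSubgroup.zsmul_mem (hmem w b) _)
  have hpos : ∀ i, ∀ n ∈ N, f (.pos i) * n ∈ N := by
    intro i
    refine hgen _ fun w b => ?_
    -- `Xᵢ⁺` moves to the right through the word: crossing a letter leaves `Xᵢ⁺` on a shorter word
    -- and, if the letter is `Xᵢ⁻`, also a coroot term.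
    induction w with
    | nil =>
      have := hmem [] (Borel.pos R i * b)
      rw [List.map_nil, List.prod_nil, one_mul] at this ⊢
      rwa [← hβpos, ← map_mul]
    | cons j w ih =>
      rw [List.map_cons, List.prod_cons, mul_assoc, ← mul_assoc]
      by_cases hij : i = j
      · subst hij
        rw [hf.pos_neg_self, add_mul, mul_assoc]
        exact N.add_mem (hneg i _ ih) (hcartan _ _ (hmem w b))
      · rw [(hf.pos_neg i j hij).eq, mul_assoc]
        exact hneg j _ ih
  have hall : ∀ x : FreeAlgebra k (Gen I Y), ∀ n ∈ N, FreeAlgebra.lift k f x * n ∈ N := by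
    intro x
    induction x using FreeAlgebra.induction with
    | grade0 c =>
      intro n hn
      rw [AlgHom.commutes, ← Algebra.smul_def]
      exact N.smul_mem c hn
    | grade1 g =>
      rw [FreeAlgebra.lift_ι_apply]
      cases g with
      | neg i => exact hneg i
      | pos i => exact hpos i
      | cartan μ => exact hcartan μ
    | mul x y hx hy =>
      intro n hn
      rw [map_mul, mul_assoc]
      exact hx _ (hy n hn)
    | add x y hx hy =>
      intro n hn
      rw [map_add, add_mul]
      exact N.add_mem (hx n hn) (hy n hn)
  have := hall x 1 (by simpa using hmem [] 1)
  rw [mul_one] at this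
  exact this

end spanning

/-- Continuity: the extension fixes `h`, so modulo `hⁿ⁺¹` an element of the closure has the same
image as an element of the ideal. -/
lemma genRep_eq_zero_of_mem_hClosure {k I Y A : Type*} [Field k] [Ring A] [Algebra k A]
    {L : I → A} {H : Y → A} {T : I → A⟦X⟧} {s : Set (FreeFormalAlgebra k (Gen I Y))}
    (hs : ∀ x ∈ s, continuousExtension (genRep (k := k) L H T).toRingHom x = 0)
    {x : FreeFormalAlgebra k (Gen I Y)} (hx : x ∈ hClosure k (TwoSidedIdeal.span s)) :
    continuousExtension (genRep (k := k) L H T).toRingHom x = 0 := by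
  ext1 n
  obtain ⟨y, hy, z, rfl⟩ := mem_hClosure.1 hx (n + 1)
  have hy' : continuousExtension (genRep (k := k) L H T).toRingHom y = 0 :=
    eq_zero_of_mem_span (continuousExtension (genRep (k := k) L H T).toRingHom) hs hy
  rw [map_add, hy', zero_add, X_pow_smul_formal, map_mul, map_pow,
    continuousExtension_X, coeff_X_pow_mul', if_neg (by omega), map_zero]

/-! ### The specialisation of `Ũ_h` -/

section tilde

variable {k I Λ Y : Type*} [Field k] [AddCommGroup Λ] [AddCommGroup Y] (R : RootDatum I Λ Y)

variable (k) in
/-- The canonical morphism from the free Lie algebra to `U(𝔤_F)`. -/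
def UF.ofFree : FreeLieAlgebra k (Gen I Y) →ₗ⁅k⁆ UF R k :=
  (UniversalEnvelopingAlgebra.ι k).comp
    { ((idealF R k).toSubmodule.mkQ : FreeLieAlgebra k (Gen I Y) →ₗ[k] LieF R k) with
      map_lie' := rfl }

variable (k) in
/-- The canonical morphism from the free Lie algebra to `U(𝔤̃)`. -/
def UTilde.ofFree : FreeLieAlgebra k (Gen I Y) →ₗ⁅k⁆ UTilde R k :=
  (UniversalEnvelopingAlgebra.ι k).comp
    { ((idealTilde R k).toSubmodule.mkQ : FreeLieAlgebra k (Gen I Y) →ₗ[k] LieTilde R k) with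
      map_lie' := rfl }

lemma UF.ofFree_nonDefRel {x : FreeLieAlgebra k (Gen I Y)}
    (hx : NonDefRel R (FreeLieAlgebra.of k) x) : UF.ofFree k R x = 0 := by
  have : ((idealF R k).toSubmodule.mkQ : FreeLieAlgebra k (Gen I Y) →ₗ[k] LieF R k) x = 0 :=
    (Submodule.Quotient.mk_eq_zero _).2 (LieSubmodule.subset_lieSpan hx)
  exact (congrArg (UniversalEnvelopingAlgebra.ι k : LieF R k →ₗ⁅k⁆ UF R k) this).trans (map_zero _)

lemma UTilde.ofFree_pos_neg (i : I) :
    UTilde.ofFree k R (⁅FreeLieAlgebra.of k (Gen.pos i : Gen I Y),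
      FreeLieAlgebra.of k (Gen.neg i)⁆ - FreeLieAlgebra.of k (Gen.cartan (R.coroot i))) = 0 := by
  have := (Submodule.Quotient.mk_eq_zero (idealTilde R k).toSubmodule).2
    (LieSubmodule.subset_lieSpan (Set.mem_union_right _ ⟨i, rfl⟩))
  refine (congrArg (UniversalEnvelopingAlgebra.ι k : LieTilde R k →ₗ⁅k⁆ UTilde R k) this).trans ?_
  exact map_zero _

lemma UTilde.point_ofFree (x : FreeLieAlgebra k (Gen I Y)) :
    UTilde.point R k (UF.ofFree k R x) = UTilde.ofFree k R x := by
  rw [UTilde.point, UF.ofFree, LieHom.comp_apply, UniversalEnvelopingAlgebra.lift_ι_apply]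
  rfl

lemma UF.algHom_ext {U : Type*} [Ring U] [Algebra k U] {φ φ' : UF R k →ₐ[k] U}
    (h : ∀ x, φ (UF.ofFree k R x) = φ' (UF.ofFree k R x)) : φ = φ' := by
  refine UniversalEnvelopingAlgebra.hom_ext k (LieHom.ext fun x => ?_)
  induction x using Submodule.Quotient.induction_on with | H x => ?_
  exact h x

lemma UTilde.algHom_ext {U : Type*} [Ring U] [Algebra k U] {φ φ' : UTilde R k →ₐ[k] U}
    (h : ∀ x, φ (UTilde.ofFree k R x) = φ' (UTilde.ofFree k R x)) : φ = φ' := by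
  refine UniversalEnvelopingAlgebra.hom_ext k (LieHom.ext fun x => ?_)
  induction x using Submodule.Quotient.induction_on with | H x => ?_
  exact h x

/-- A morphism from `U(𝔤_F)` which respects the relations `[Xᵢ⁺, Xᵢ⁻] = αᵢ` factors through
`U(𝔤̃)`. -/
lemma UTilde.exists_lift {U : Type*} [Ring U] [Algebra k U] (φ : UF R k →ₐ[k] U)
    (hφ : ∀ i, φ (UF.ofFree k R (⁅FreeLieAlgebra.of k (Gen.pos i : Gen I Y),
      FreeLieAlgebra.of k (Gen.neg i)⁆ - FreeLieAlgebra.of k (Gen.cartan (R.coroot i)))) = 0) :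
    ∃ F : UTilde R k →ₐ[k] U, ∀ x, F (UTilde.point R k x) = φ x := by
  let Φ : FreeLieAlgebra k (Gen I Y) →ₗ⁅k⁆ U := (φ : UF R k →ₗ⁅k⁆ U).comp (UF.ofFree k R)
  have hle : idealTilde R k ≤ Φ.ker := by
    refine LieSubmodule.lieSpan_le.2 ?_
    rintro x (hx | ⟨i, rfl⟩)
    · refine LieHom.mem_ker.2 ?_
      change φ (UF.ofFree k R x) = 0
      rw [UF.ofFree_nonDefRel R hx, map_zero]
    · exact LieHom.mem_ker.2 (hφ i)
  let Ψ : LieTilde R k →ₗ⁅k⁆ U :=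
    { (idealTilde R k).toSubmodule.liftQ (Φ : FreeLieAlgebra k (Gen I Y) →ₗ[k] U)
        (fun _ hx => LieHom.mem_ker.1 (hle hx)) with
      map_lie' := by
        intro x y
        induction x using Submodule.Quotient.induction_on with | H x => ?_
        induction y using Submodule.Quotient.induction_on with | H y => ?_
        exact Φ.map_lie x y }
  let F : UTilde R k →ₐ[k] U := UniversalEnvelopingAlgebra.lift k Ψ
  have : F.comp (UTilde.point R k) = φ := by
    refine UF.algHom_ext R fun x => ?_
    rw [AlgHom.comp_apply, UTilde.point_ofFree, UTilde.ofFree, LieHom.comp_apply]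
    exact UniversalEnvelopingAlgebra.lift_ι_apply k Ψ _
  exact ⟨F, DFunLike.congr_fun this⟩

variable (k) in
/-- The generators of `U(𝔤̃)`. -/
def UTilde.gen (g : Gen I Y) : UTilde R k := UTilde.ofFree k R (FreeLieAlgebra.of k g)

lemma UTilde.ofFree_nonDefRel {x : FreeLieAlgebra k (Gen I Y)}
    (hx : NonDefRel R (FreeLieAlgebra.of k) x) : UTilde.ofFree k R x = 0 := by
  rw [← UTilde.point_ofFree, UF.ofFree_nonDefRel R hx, map_zero]

lemma UTilde.isTildeFamily : IsTildeFamily R (UTilde.gen k R) where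
  add μ ν := by
    have := UTilde.ofFree_nonDefRel (k := k) R (.add μ ν)
    rwa [map_sub, map_add, sub_eq_zero] at this
  comm μ ν := by
    have := UTilde.ofFree_nonDefRel (k := k) R (.comm μ ν)
    rwa [LieHom.map_lie, Ring.lie_def, sub_eq_zero] at this
  pos μ i := by
    have := UTilde.ofFree_nonDefRel (k := k) R (.weight_pos μ i)
    rwa [map_sub, map_zsmul, LieHom.map_lie, Ring.lie_def, sub_eq_zero, sub_eq_iff_eq_add'] at this
  neg μ i := by
    have := UTilde.ofFree_nonDefRel (k := k) R (.weight_neg μ i)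
    rwa [map_sub, map_zsmul, LieHom.map_lie, Ring.lie_def, sub_eq_zero, sub_eq_iff_eq_add'] at this
  pos_neg i j hij := by
    have := UTilde.ofFree_nonDefRel (k := k) R (.pos_neg i j hij)
    rwa [LieHom.map_lie, Ring.lie_def, sub_eq_zero] at this
  pos_neg_self i := by
    have := UTilde.ofFree_pos_neg (k := k) R i
    rwa [map_sub, LieHom.map_lie, Ring.lie_def, sub_eq_zero, sub_eq_iff_eq_add'] at this

lemma constantCoeff_gqeSeries {S : NullSequence k}
    (hS : ∀ a, coeff 0 (S.1 a) = classicalSolution a) (i : I) :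
    constantCoeff (gqeSeries R S i) = FreeAlgebra.ι k (Gen.cartan (R.coroot i)) +
      FreeAlgebra.ι k (Gen.neg i) * FreeAlgebra.ι k (Gen.pos i) := by
  rw [← coeff_zero_eq_constantCoeff_apply, gqeSeries, coeff_mk]
  have := finsum_classicalSolution (k := k) (FreeAlgebra.ι k (Gen.neg i : Gen I Y))
    (FreeAlgebra.ι k (Gen.cartan (R.coroot i))) fun a => FreeAlgebra.ι k (Gen.pos i) ^ a
  rw [pow_zero, pow_one, mul_one] at this
  rw [← this]
  exact finsum_congr fun a => by rw [← hS]

variable {R}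

lemma IsTildeFamily.lift_constantCoeff_eq_zero {S : I → NullSequence k}
    (hS : ∀ i a, coeff 0 ((S i).1 a) = classicalSolution a) {U : Type*} [Ring U] [Algebra k U]
    {f : Gen I Y → U} (hf : IsTildeFamily R f) {r : FreeFormalAlgebra k (Gen I Y)}
    (hr : r ∈ relTilde R S) : FreeAlgebra.lift k f (constantCoeff r) = 0 := by
  rcases hr with hr | ⟨i, rfl⟩
  · have h := hr.map_ringHom ((FreeAlgebra.lift k f).toRingHom.comp constantCoeff)
    have hgen : ((FreeAlgebra.lift k f).toRingHom.comp constantCoeff) ∘ GQE.gen k = f := by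
      funext g
      change FreeAlgebra.lift k f (constantCoeff (C _)) = _
      rw [constantCoeff_C, FreeAlgebra.lift_ι_apply]
    rw [hgen] at h
    exact h.eq_zero hf.add hf.comm hf.pos hf.neg hf.pos_neg
  · rw [map_sub, map_mul, constantCoeff_gqeSeries R (hS i), GQE.gen, GQE.gen, constantCoeff_C,
      constantCoeff_C]
    simp only [map_sub, map_mul, map_add, FreeAlgebra.lift_ι_apply]
    rw [hf.pos_neg_self]
    abel

lemma UhTilde.point_ofFree (S : I → NullSequence k) (g : Gen I Y) :
    UhTilde.point R S (UF.ofFree k R (FreeLieAlgebra.of k g)) =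
      TopPresented.of (relTilde R S) g := by
  rw [UhTilde.point, UF.ofFree, LieHom.comp_apply, UniversalEnvelopingAlgebra.lift_ι_apply]
  exact FreeLieAlgebra.lift_of_apply _ _

/-- The specialisation of `Ũ_h` is isomorphic to `U(𝔤̃)`. -/
lemma exists_specialisation_equiv {S : I → NullSequence k}
    (hS : ∀ i a, coeff 0 ((S i).1 a) = classicalSolution a) :
    ∃ e : Specialisation k (UhTilde R S) ≃ₐ[k] UTilde R k,
      (∀ x, e (specialisationMap k _ (UhTilde.point R S x)) = UTilde.point R k x) ∧
      ∀ x, e (freeToSpecialisation (relTilde R S) x) = FreeAlgebra.lift k (UTilde.gen k R) x := by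
  obtain ⟨E, hE⟩ := exists_specialisation_lift (rels := relTilde R S)
    (FreeAlgebra.lift k (UTilde.gen k R))
    fun r hr => (UTilde.isTildeFamily R).lift_constantCoeff_eq_zero hS hr
  let φ : UF R k →ₐ[k] Specialisation k (UhTilde R S) :=
    (specialisationMap k (UhTilde R S)).comp (UhTilde.point R S)
  have hφ : ∀ g, φ (UF.ofFree k R (FreeLieAlgebra.of k g)) =
      freeToSpecialisation (relTilde R S) (FreeAlgebra.ι k g) := by
    intro g
    rw [AlgHom.comp_apply, UhTilde.point_ofFree, freeToSpecialisation, FreeAlgebra.lift_ι_apply]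
  -- The inverse of `E` exists because the constant term of the deformed relation is `Xᵢ⁺ Xᵢ⁻ - Xᵢ⁻
  -- Xᵢ⁺ - αᵢ`.
  obtain ⟨F, hF⟩ := UTilde.exists_lift R φ fun i => by
    have hi : GQE.gen k (.pos i) * GQE.gen k (.neg i) - gqeSeries R (S i) i ∈ relTilde R S :=
      Or.inr ⟨i, rfl⟩
    have h := congrArg (specialisationMap k (UhTilde R S)) (TopPresented.mk_eq_zero _ hi)
    rw [specialisationMap_mk, map_sub, map_mul, constantCoeff_gqeSeries R (hS i), GQE.gen, GQE.gen,
      constantCoeff_C, constantCoeff_C, map_sub, map_add, map_mul, map_mul, map_zero] at h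
    rw [map_sub, LieHom.map_lie, Ring.lie_def, map_sub, map_sub, map_mul, map_mul, hφ, hφ, hφ,
      ← h]
    abel
  have hEφ : ∀ x, E (φ x) = UTilde.point R k x := by
    have h1 : (((E.comp φ : UF R k →ₐ[k] UTilde R k) : UF R k →ₗ⁅k⁆ UTilde R k)).comp
        (UF.ofFree k R) = UTilde.ofFree k R := by
      refine FreeLieAlgebra.hom_ext fun g => ?_
      change E (φ (UF.ofFree k R (FreeLieAlgebra.of k g))) = _
      rw [hφ, hE, FreeAlgebra.lift_ι_apply]
      rfl
    have h2 : E.comp φ = UTilde.point R k := by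
      refine UF.algHom_ext R fun x => ?_
      rw [UTilde.point_ofFree]
      exact DFunLike.congr_fun h1 x
    exact DFunLike.congr_fun h2
  have hEF : E.comp F = AlgHom.id k _ := by
    refine UTilde.algHom_ext R fun x => ?_
    rw [← UTilde.point_ofFree, AlgHom.comp_apply, hF, hEφ]
    rfl
  have hFE : F.comp (FreeAlgebra.lift k (UTilde.gen k R)) =
      freeToSpecialisation (relTilde R S) := by
    refine FreeAlgebra.hom_ext (funext fun g => ?_)
    rw [Function.comp_apply, Function.comp_apply, AlgHom.comp_apply, FreeAlgebra.lift_ι_apply,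
      UTilde.gen, ← UTilde.point_ofFree, hF, hφ]
  have hFE' : F.comp E = AlgHom.id k _ := by
    refine AlgHom.ext fun y => ?_
    obtain ⟨x, rfl⟩ := freeToSpecialisation_surjective y
    rw [AlgHom.comp_apply, hE, ← AlgHom.comp_apply, hFE]
    rfl
  exact ⟨AlgEquiv.ofAlgHom E F hEF hFE', hEφ, hE⟩

/-! ### Topological freeness -/

/-- The series `(v - v₀ - v₁ h - ⋯ - vₙ₋₁ hⁿ⁻¹) / hⁿ`. -/
def FormalModule.tail {V : Type*} (n : ℕ) (v : FormalModule V) : FormalModule V :=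
  fun m => v (n + m)

/-- The map from the formal module of `Induced` to `k⟨G⟩⟦h⟧` induced by normal forms. -/
def formalNormalForm (R : RootDatum I Λ Y) :
    FormalModule (Induced k R) →ₗ[k⟦X⟧] FreeFormalAlgebra k (Gen I Y) where
  toFun v := PowerSeries.mk fun m => normalForm R (v m)
  map_add' v w := by
    ext m
    rw [map_add, coeff_mk, coeff_mk, coeff_mk, ← map_add]
    rfl
  map_smul' c v := by
    ext m
    rw [RingHom.id_apply, Algebra.smul_def]
    change _ = coeff m (PowerSeries.map _ c * _)
    rw [coeff_mk, coeff_mul]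
    change normalForm R (∑ pq ∈ Finset.HasAntidiagonal.antidiagonal m, _) = _
    rw [map_sum]
    refine Finset.sum_congr rfl fun pq _ => ?_
    rw [coeff_map, coeff_mk, map_smul, Algebra.smul_def]

lemma coeff_formalNormalForm (v : FormalModule (Induced k R)) (m : ℕ) :
    coeff m (formalNormalForm R v) = normalForm R (v m) := by
  change coeff m (PowerSeries.mk fun m => normalForm R (v m)) = _
  rw [coeff_mk]

lemma formalNormalForm_tail (v : FormalModule (Induced k R)) : formalNormalForm R v =
    C (normalForm R (v 0)) + (X : k⟦X⟧) • formalNormalForm R (v.tail 1) := by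
  rw [← pow_one (X : k⟦X⟧), X_pow_smul_formal, pow_one]
  ext m
  rw [coeff_formalNormalForm, map_add]
  cases m with
  | zero => simp
  | succ m =>
    rw [coeff_succ_X_mul, coeff_formalNormalForm, coeff_C, if_neg m.succ_ne_zero, zero_add]
    exact congrArg (fun j => normalForm R (v j)) (add_comm m 1)

/-- The action on `Induced⟦h⟧` annihilates the relations and their closure, and applied to `1 ⊗ 1`
it recovers every coefficient of `v`. -/
lemma formalNormalForm_eq_zero {S : I → NullSequence k}
    (hS : ∀ i a, coeff 0 ((S i).1 a) = classicalSolution a) {v : FormalModule (Induced k R)}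
    (hv : TopPresented.mk (relTilde R S) (formalNormalForm R v) = 0) : v = 0 := by
  obtain ⟨T, hT, hrel⟩ := exists_inducedRep R hS
  let φ := continuousExtension (genRep (k := k) (prepend R) (cartanOp R) T).toRingHom
  have hφ : φ (formalNormalForm R v) = 0 :=
    genRep_eq_zero_of_mem_hClosure hrel (TopPresented.mk_eq_zero_iff.1 hv)
  funext n
  have h1 := congrArg (fun t : (InducedEnd k R)⟦X⟧ => coeff n t (Finsupp.single [] 1)) hφ
  simp only [φ, coeff_continuousExtension, LinearMap.sum_apply, map_zero,
    coeff_formalNormalForm] at h1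
  have h2 : ∀ ij ∈ Finset.HasAntidiagonal.antidiagonal n,
      coeff ij.2 ((genRep (k := k) (prepend R) (cartanOp R) T).toRingHom
        (normalForm R (v ij.1))) (Finsupp.single [] 1) = if ij.2 = 0 then v ij.1 else 0 :=
    fun ij _ => sendsTo_normalForm hT (v ij.1) ij.2
  rw [Finset.sum_congr rfl h2, Finset.sum_eq_single (n, 0)] at h1
  · exact h1
  · rintro ⟨a, b⟩ hab hne
    refine if_neg ?_
    rintro rfl
    simp at hab
    exact hne (by rw [hab])
  · intro hn
    simp at hn

/-- Successive approximation: each element is a normal form modulo `h`, and the remainder divided by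
`h` is treated in the same way. -/
lemma formalNormalForm_surjective {S : I → NullSequence k}
    (hS : ∀ i a, coeff 0 ((S i).1 a) = classicalSolution a) (x : UhTilde R S) :
    ∃ v, TopPresented.mk (relTilde R S) (formalNormalForm R v) = x := by
  obtain ⟨e, -, he⟩ := exists_specialisation_equiv (R := R) hS
  have hstep : ∀ x : UhTilde R S, ∃ (v : Induced k R) (z : UhTilde R S),
      x = TopPresented.mk (relTilde R S) (C (normalForm R v)) + (X : k⟦X⟧) • z := by
    intro x
    obtain ⟨y, hy⟩ := freeToSpecialisation_surjective (specialisationMap k _ x)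
    -- Spanning is known in `U(𝔤̃)`; the injectivity of `e` carries it back to the specialisation.
    obtain ⟨v, hv⟩ := (UTilde.isTildeFamily (k := k) R).exists_normalForm y
    rw [← he, ← he] at hv
    have h := e.injective hv
    rw [hy, ← specialisationMap_mk_C, eq_comm, ← sub_eq_zero, ← map_sub,
      specialisationMap_eq_zero_iff] at h
    obtain ⟨z, hz⟩ := h
    exact ⟨v, z, by rw [← hz, add_sub_cancel]⟩
  choose v z hvz using hstep
  let w : FormalModule (Induced k R) := fun m => v (z^[m] x)
  refine ⟨w, ?_⟩
  have hrem : ∀ m, TopPresented.mk (relTilde R S) (formalNormalForm R w) - x = (X : k⟦X⟧) ^ m •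
      (TopPresented.mk (relTilde R S) (formalNormalForm R (w.tail m)) - z^[m] x) := by
    intro m
    induction m with
    | zero =>
      rw [show w.tail 0 = w from funext fun m => congrArg w (zero_add m), pow_zero, one_smul]
      rfl
    | succ m ih =>
      have h1 := hvz (z^[m] x)
      have h2 : (w.tail m).tail 1 = w.tail (m + 1) :=
        funext fun j => congrArg w (add_assoc m 1 j).symm
      have h3 : w.tail m 0 = v (z^[m] x) := rfl
      rw [ih, pow_succ, mul_smul, Function.iterate_succ_apply', formalNormalForm_tail, h2, h3,
        map_add, map_smul]
      conv_lhs => enter [2, 2]; rw [h1]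
      rw [add_sub_add_left_eq_sub, ← smul_sub]
  obtain ⟨f, rfl⟩ := TopPresented.mk_surjective x
  -- The difference lies in `hᵐ Ũ_h` for every `m`. Lifting this to the free formal algebra and
  -- approximating the resulting element of the closure modulo `hᵐ` puts the difference in `J + hᵐ`,
  -- with `J` the ideal spanned by the relations.
  rw [← sub_eq_zero, ← map_sub, TopPresented.mk_eq_zero_iff, mem_hClosure]
  intro m
  have hy := hrem m
  generalize TopPresented.mk (relTilde R S) (formalNormalForm R (w.tail m)) - _ = y at hy
  obtain ⟨g, rfl⟩ := TopPresented.mk_surjective y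
  rw [← map_sub, ← map_smul, ← sub_eq_zero, ← map_sub, TopPresented.mk_eq_zero_iff,
    mem_hClosure] at hy
  obtain ⟨y, hy, g', hg'⟩ := hy m
  refine ⟨y, hy, g' + g, ?_⟩
  rw [smul_add, ← add_assoc, ← hg', sub_add_cancel]

/-- The algebra `Ũ_h` is a formal deformation of `U(𝔤̃)`. -/
lemma isFormalDeformation {S : I → NullSequence k}
    (hS : ∀ i a, coeff 0 ((S i).1 a) = classicalSolution a) :
    IsFormalDeformation k (UTilde.point R k) (UhTilde.point R S) := by
  obtain ⟨e, he, -⟩ := exists_specialisation_equiv (R := R) hS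
  refine ⟨⟨Induced k R, inferInstance, inferInstance, ⟨LinearEquiv.ofBijective
    ((TopPresented.mk (relTilde R S)).toLinearMap ∘ₗ formalNormalForm R) ⟨?_, ?_⟩⟩⟩, e, he⟩
  · rw [← LinearMap.ker_eq_bot, LinearMap.ker_eq_bot']
    exact fun v hv => formalNormalForm_eq_zero hS hv
  · exact formalNormalForm_surjective hS

end tilde

end GQE

end

theorem theoremI {k : Type*} [Field k] [CharZero k] {I Λ Y : Type*} [Finite I]
    [AddCommGroup Λ] [Module.Free ℤ Λ] [Module.Finite ℤ Λ]
    [AddCommGroup Y] [Module.Free ℤ Y] [Module.Finite ℤ Y]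
    (R : GQE.RootDatum I Λ Y) (ψ : I → GQE.Colouring k) (hψ : ∀ i, (ψ i).IsHAdmissible) :
    (∀ i, ∃! M : GQE.NullSequence k, GQE.IsGQESolution (ψ i) (ψ i) (-1) M) ∧
    ∀ S : I → GQE.NullSequence k, (∀ i, GQE.IsGQESolution (ψ i) (ψ i) (-1) (S i)) →
      GQE.IsFormalDeformation k (GQE.UTilde.point R k) (GQE.UhTilde.point R S) := by
  refine ⟨fun i => ?_, fun S hS =>
    GQE.isFormalDeformation fun i a => (hS i).constantCoeff_eq (hψ i) a⟩
  obtain ⟨M, hM⟩ := GQE.exists_isGQESolution (hψ i)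
  exact ⟨M, hM, fun N hN => hN.unique (hψ i) hM⟩
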